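/- Let $u\colon R\to U$ be a homomorphism of associative unital rings which is a ring epimorphism, i.e., the multiplication map $U\otimes_R U\to U$ is an isomorphism. Assume that $\operatorname{Tor}_1^R(U,U)=0=\operatorname{Tor}_2^R(U,U)$. Let $K^\bullet$ be the two-term complex of $R$-$R$-bimodules $R\xrightarrow{u}U$ with $R$ in cohomological degree $-1$ and $U$ in degree $0$. For a left $R$-module $B$ put $\operatorname{Ext}_R^n(K^\bullet,B)=\operatorname{Hom}_{\mathsf D(R\text{-Mod})}(K^\bullet,B[n])$, with the left $R$-module structure induced by the right action of $R$ on $K^\bullet$, and for a left $R$-module $A$ put $\operatorname{Tor}^R_n(K^\bullet,A)=H^{-n}(K^\bullet\otimes^{\mathbb L}_R A)$, with the left $R$-module structure induced by the left action of $R$ on $K^\bullet$. A left $R$-module $M$ is a *$u$-comodule* if $U\otimes_R M=0=\operatorname{Tor}_1^R(U,M)$, and it is *$u$-cospecial* if the map $\operatorname{Hom}_R(U,M)\to M$, $f\mapsto f(1)$, is injective. A left $R$-module $C$ is a *$u$-contramodule* if $\operatorname{Hom}_R(U,C)=0=\operatorname{Ext}^1_R(U,C)$, and it is *$u$-special* if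 the map $C\to U\otimes_R C$, $c\mapsto 1\otimes c$, is surjective. Then the functor $M\mapsto\operatorname{Ext}^1_R(K^\bullet,M)$ takes $u$-cospecial left $u$-comodules to $u$-special left $u$-contramodules, the functor $C\mapsto\operatorname{Tor}_1^R(K^\bullet,C)$ takes $u$-special left $u$-contramodules to $u$-cospecial left $u$-comodules, and the restrictions of these two functors are mutually inverse equivalences between the additive categories (full subcategories of left $R$-modules) of $u$-cospecial left $u$-comodules and of $u$-special left $u$-contramodules. -/

import Mathlib

open CategoryTheory CategoryTheory.Limits
open scoped TensorProduct

universe v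

namespace Matlis

noncomputable section

variable {R U : Type v} [Ring R] [Ring U] (u : R →+* U)

/-! ### Extension of scalars along a homomorphism of noncommutative rings -/

/-- The relations `v u(r) ⊗ m = v ⊗ r m` cutting out `U ⊗_R M` from `U ⊗_ℤ M`. -/
def tensorRel (M : Type v) [AddCommGroup M] [Module R M] : Submodule U (U ⊗[ℤ] M) :=
  Submodule.span U {t | ∃ (v : U) (r : R) (m : M), t = (v * u r) ⊗ₜ[ℤ] m - v ⊗ₜ[ℤ] (r • m)}

/-- The left `U`-module `U ⊗_R M`, where `U` is a right `R`-module through `u`. -/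
abbrev BaseChange (M : Type v) [AddCommGroup M] [Module R M] : Type v :=
  (U ⊗[ℤ] M) ⧸ tensorRel u M

/-- The pure tensor `v ⊗ m` in `U ⊗_R M`. -/
def tmul {M : Type v} [AddCommGroup M] [Module R M] (v : U) (m : M) : BaseChange u M :=
  (tensorRel u M).mkQ (v ⊗ₜ[ℤ] m)

theorem mul_tmul {M : Type v} [AddCommGroup M] [Module R M] (v : U) (r : R) (m : M) :
    tmul u (v * u r) m = tmul u v (r • m) := by
  rw [tmul, tmul, ← sub_eq_zero, ← map_sub, Submodule.mkQ_apply, Submodule.Quotient.mk_eq_zero]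
  exact Submodule.subset_span ⟨v, r, m, rfl⟩

theorem baseChange_hom_ext {M : Type v} [AddCommGroup M] [Module R M]
    {N : Type v} [AddCommGroup N] [Module U N] {f g : BaseChange u M →ₗ[U] N}
    (h : ∀ m : M, f (tmul u 1 m) = g (tmul u 1 m)) : f = g := by
  apply Submodule.linearMap_qext
  apply TensorProduct.AlgebraTensorModule.ext
  intro v m
  have hv : v ⊗ₜ[ℤ] m = v • ((1 : U) ⊗ₜ[ℤ] m) := by
    rw [TensorProduct.smul_tmul', smul_eq_mul, mul_one]
  rw [hv, map_smul, map_smul]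
  exact congrArg (v • ·) (h m)

/-- The map `U ⊗_R M → U ⊗_R N` induced by an `R`-linear map `M → N`. -/
def baseChangeMap {M N : Type v} [AddCommGroup M] [Module R M] [AddCommGroup N] [Module R N]
    (f : M →ₗ[R] N) : BaseChange u M →ₗ[U] BaseChange u N :=
  Submodule.mapQ _ _
    (TensorProduct.AlgebraTensorModule.map (LinearMap.id : U →ₗ[U] U) f.toAddMonoidHom.toIntLinearMap)
    (by
      rw [tensorRel, Submodule.span_le]
      rintro _ ⟨v, r, m, rfl⟩
      refine Submodule.subset_span ⟨v, r, f m, ?_⟩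
      simp)

@[simp]
theorem baseChangeMap_tmul {M N : Type v} [AddCommGroup M] [Module R M] [AddCommGroup N]
    [Module R N] (f : M →ₗ[R] N) (v : U) (m : M) :
    baseChangeMap u f (tmul u v m) = tmul u v (f m) := rfl

/-- The functor `u^* = U ⊗_R - : R-Mod ⥤ U-Mod`. -/
def baseChange : ModuleCat.{v} R ⥤ ModuleCat.{v} U where
  obj M := ModuleCat.of U (BaseChange u M)
  map f := ModuleCat.ofHom (baseChangeMap u f.hom)
  map_id M := by
    ext1
    exact baseChange_hom_ext u fun m => rfl
  map_comp f g := by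
    ext1
    exact baseChange_hom_ext u fun m => rfl

/-- The endofunctor `U ⊗_R -` of the category of left `R`-modules. -/
def tensorU : ModuleCat.{v} R ⥤ ModuleCat.{v} R :=
  baseChange u ⋙ ModuleCat.restrictScalars u

theorem tmul_add {M : Type v} [AddCommGroup M] [Module R M] (v : U) (m m' : M) :
    tmul u v (m + m') = tmul u v m + tmul u v m' := by
  simp [tmul, TensorProduct.tmul_add]

instance : (baseChange u).Additive where
  map_add {M N f g} := by
    ext1
    exact baseChange_hom_ext u fun m => tmul_add u 1 (f.hom m) (g.hom m)

instance : (tensorU u).Additive := by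
  unfold tensorU
  infer_instance

/-- The natural map `A → U ⊗_R A`, `a ↦ 1 ⊗ a`. -/
def unitMap : 𝟭 (ModuleCat.{v} R) ⟶ tensorU u where
  app A := ModuleCat.ofHom (Y := (tensorU u).obj A)
    { toFun := fun a => tmul u 1 a
      map_add' := fun a a' => tmul_add u 1 a a'
      map_smul' := fun r a => by
        change tmul u 1 (r • a) = u r • tmul u 1 a
        rw [← mul_tmul, tmul, tmul, ← map_smul, TensorProduct.smul_tmul', smul_eq_mul, mul_one,
          one_mul] }
  naturality _ _ _ := rfl

/-- `U` as a left `R`-module. -/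
abbrev leftU : ModuleCat.{v} R := (ModuleCat.restrictScalars u).obj (ModuleCat.of U U)

/-- The multiplication map `U ⊗_R U → U`, `v ⊗ w ↦ v w`. -/
def mulMap : BaseChange u (leftU u) →ₗ[U] U :=
  Submodule.liftQ _
    (TensorProduct.AlgebraTensorModule.lift
      { toFun := fun v : U => (LinearMap.mulLeft ℤ v : U →ₗ[ℤ] U)
        map_add' := fun v w => by ext x; exact add_mul v w x
        map_smul' := fun v w => by ext x; exact mul_assoc v w x })
    (by
      rw [tensorRel, Submodule.span_le]
      rintro _ ⟨v, r, m, rfl⟩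
      refine LinearMap.mem_ker.mpr ?_
      rw [map_sub]
      exact sub_eq_zero_of_eq (mul_assoc (G := U) v (u r) m))

/-- `u` is a ring epimorphism: the multiplication map `U ⊗_R U → U` is an isomorphism. -/
def IsRingEpi : Prop := Function.Bijective (mulMap u)

/-! ### The functors `Tor` and `Ext` -/

/-- The functor `Tor_n^R(U, -)`, as a functor to left `R`-modules. -/
def torU (n : ℕ) : ModuleCat.{v} R ⥤ ModuleCat.{v} R := (tensorU u).leftDerived n

variable (R) in
/-- The canonical resolution of an `R`-module by free `R`-modules, as a functor to complexes
concentrated in nonpositive cohomological degrees. -/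
def freeResolution : ModuleCat.{v} R ⥤ CochainComplex (ModuleCat.{v} R) ℤ :=
  (ModuleCat.projectiveResolution R).chainComplexFunctor ⋙
    (ObjectProperty.ι (isProjective (ModuleCat.{v} R))).mapHomologicalComplex _ ⋙
    ComplexShape.embeddingDownNat.extendFunctor _

/-- The functor `P ↦ K ⊗_R P` on complexes of left `R`-modules, where `K` is the complex of
bimodules `R → U` in degrees `-1` and `0`: the total complex of `P = R ⊗_R P → U ⊗_R P`, that is,
the cone of the natural map `P → U ⊗_R P`. -/
def tensorK : CochainComplex (ModuleCat.{v} R) ℤ ⥤ CochainComplex (ModuleCat.{v} R) ℤ where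
  obj P := CochainComplex.mappingCone
    ((NatTrans.mapHomologicalComplex (unitMap u) (ComplexShape.up ℤ)).app P)
  map f := CochainComplex.mappingCone.map _ _
    ((𝟭 (ModuleCat.{v} R)).mapHomologicalComplex _ |>.map f)
    ((tensorU u).mapHomologicalComplex _ |>.map f)
    (NatTrans.naturality _ f).symm
  map_id P := by
    rw [← CochainComplex.mappingCone.map_id]
    congr 1
    exact CategoryTheory.Functor.map_id _ _
  map_comp f g := by
    rw [← CochainComplex.mappingCone.map_comp]
    congr 1
    exact CategoryTheory.Functor.map_comp _ _ _

/-- The functor `Tor_n^R(K, -) = H^{-n}(K ⊗^L_R -)`, with values in left `R`-modules, the derived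
tensor product being computed by a free resolution of the argument. -/
def torK (n : ℤ) : ModuleCat.{v} R ⥤ ModuleCat.{v} R :=
  freeResolution R ⋙ tensorK u ⋙ HomologicalComplex.homologyFunctor _ _ (-n)

/-- The map `u : R → U` of left `R`-modules. -/
def uHom : ModuleCat.of R R ⟶ leftU u :=
  ModuleCat.ofHom (Y := leftU u)
    { toFun := fun r => u r
      map_add' := fun r s => map_add u r s
      map_smul' := fun r s => map_mul u r s }

/-- The complex `K = (R → U)` of left `R`-modules with `R` in degree `-1` and `U` in degree `0`,
as the cone of `u : R → U` (both placed in degree `0`). -/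
abbrev complexK : CochainComplex (ModuleCat.{v} R) ℤ :=
  CochainComplex.mappingCone ((CochainComplex.singleFunctor (ModuleCat.{v} R) 0).map (uHom u))

/-- Right multiplication by `r` on `R`. -/
def rightMulR (r : R) : ModuleCat.of R R ⟶ ModuleCat.of R R :=
  ModuleCat.ofHom (LinearMap.toSpanSingleton R R r)

/-- Right multiplication by `u r` on `U`. -/
def rightMulU (r : R) : leftU u ⟶ leftU u :=
  (ModuleCat.restrictScalars u).map (ModuleCat.ofHom (LinearMap.toSpanSingleton U U (u r)))

theorem uHom_rightMul (r : R) : uHom u ≫ rightMulU u r = rightMulR r ≫ uHom u := by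
  apply ModuleCat.hom_ext
  apply LinearMap.ext
  intro x
  exact (map_mul u x r).symm

/-- The right action of `r : R` on the complex `K`. -/
def rightMulK (r : R) : complexK u ⟶ complexK u :=
  CochainComplex.mappingCone.map _ _
    ((CochainComplex.singleFunctor (ModuleCat.{v} R) 0).map (rightMulR r))
    ((CochainComplex.singleFunctor (ModuleCat.{v} R) 0).map (rightMulU u r))
    (by rw [← Functor.map_comp, ← Functor.map_comp, uHom_rightMul])

theorem rightMulR_add (r s : R) : rightMulR (r + s) = rightMulR r + rightMulR s := by
  apply ModuleCat.hom_ext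
  apply LinearMap.ext
  intro x
  exact mul_add x r s

theorem rightMulU_add (r s : R) : rightMulU u (r + s) = rightMulU u r + rightMulU u s := by
  apply ModuleCat.hom_ext
  apply LinearMap.ext
  intro x
  exact (congrArg ((show U from x) * ·) (map_add u r s)).trans (mul_add (show U from x) (u r) (u s))

theorem rightMulR_mul (r s : R) : rightMulR (r * s) = rightMulR r ≫ rightMulR s := by
  apply ModuleCat.hom_ext
  apply LinearMap.ext
  intro x
  exact (mul_assoc x r s).symm

theorem rightMulU_mul (r s : R) : rightMulU u (r * s) = rightMulU u r ≫ rightMulU u s := by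
  apply ModuleCat.hom_ext
  apply LinearMap.ext
  intro x
  exact (congrArg ((show U from x) * ·) (map_mul u r s)).trans
    (mul_assoc (show U from x) (u r) (u s)).symm

theorem rightMulR_one : rightMulR (1 : R) = 𝟙 _ := by
  apply ModuleCat.hom_ext
  apply LinearMap.ext
  intro x
  exact mul_one x

theorem rightMulU_one : rightMulU u 1 = 𝟙 _ := by
  apply ModuleCat.hom_ext
  apply LinearMap.ext
  intro x
  exact (congrArg ((show U from x) * ·) (map_one u)).trans (mul_one (show U from x))

theorem mappingCone_map_add {K L : CochainComplex (ModuleCat.{v} R) ℤ} (φ : K ⟶ L)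
    (a a' : K ⟶ K) (b b' : L ⟶ L) (h : φ ≫ b = a ≫ φ) (h' : φ ≫ b' = a' ≫ φ) :
    CochainComplex.mappingCone.map φ φ (a + a') (b + b') (by
      rw [Preadditive.comp_add, Preadditive.add_comp, h, h']) =
      CochainComplex.mappingCone.map φ φ a b h + CochainComplex.mappingCone.map φ φ a' b' h' := by
  apply HomologicalComplex.hom_ext
  intro n
  simp [CochainComplex.mappingCone.ext_from_iff φ (n + 1) n rfl, CochainComplex.mappingCone.map]

theorem rightMulK_add (r s : R) : rightMulK u (r + s) = rightMulK u r + rightMulK u s := by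
  unfold rightMulK
  rw [← mappingCone_map_add]
  congr 1
  · rw [rightMulR_add, Functor.map_add]
  · rw [rightMulU_add, Functor.map_add]

theorem rightMulK_mul (r s : R) : rightMulK u (r * s) = rightMulK u r ≫ rightMulK u s := by
  unfold rightMulK
  rw [← CochainComplex.mappingCone.map_comp]
  congr 1
  · rw [rightMulR_mul, Functor.map_comp]
  · rw [rightMulU_mul, Functor.map_comp]

theorem rightMulK_one : rightMulK u 1 = 𝟙 _ := by
  rw [← CochainComplex.mappingCone.map_id]
  unfold rightMulK
  congr 1
  · rw [rightMulR_one, CategoryTheory.Functor.map_id]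
  · rw [rightMulU_one, CategoryTheory.Functor.map_id]

section Ext

attribute [local instance] HasDerivedCategory.standard

/-- The set of morphisms `K ⟶ B[n]` in the derived category of left `R`-modules. -/
def HomKShift (n : ℤ) (B : ModuleCat.{v} R) : Type (v + 1) :=
  DerivedCategory.Q.obj (complexK u) ⟶
    ((DerivedCategory.singleFunctor (ModuleCat.{v} R) 0).obj B)⟦n⟧

instance (n : ℤ) (B : ModuleCat.{v} R) : AddCommGroup (HomKShift u n B) :=
  inferInstanceAs (AddCommGroup (DerivedCategory.Q.obj (complexK u) ⟶
    ((DerivedCategory.singleFunctor (ModuleCat.{v} R) 0).obj B)⟦n⟧))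

/-- The left `R`-module structure on `Hom(K, B[n])` induced by the right action of `R` on `K`. -/
instance (n : ℤ) (B : ModuleCat.{v} R) : Module R (HomKShift u n B) where
  smul r f := DerivedCategory.Q.map (rightMulK u r) ≫ f
  one_smul f := by
    have h : DerivedCategory.Q.map (rightMulK u 1) = 𝟙 _ := by
      rw [rightMulK_one, CategoryTheory.Functor.map_id]
    exact (congrArg (· ≫ f) h).trans (Category.id_comp _)
  mul_smul r s f := by
    have h : DerivedCategory.Q.map (rightMulK u (r * s)) =
        DerivedCategory.Q.map (rightMulK u r) ≫ DerivedCategory.Q.map (rightMulK u s) := by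
      rw [rightMulK_mul, Functor.map_comp]
    exact (congrArg (· ≫ f) h).trans (Category.assoc _ _ _)
  smul_zero r := Limits.comp_zero
  smul_add r f g := Preadditive.comp_add _ _ _ _ _ _
  add_smul r s f := by
    have h : DerivedCategory.Q.map (rightMulK u (r + s)) =
        DerivedCategory.Q.map (rightMulK u r) + DerivedCategory.Q.map (rightMulK u s) := by
      rw [rightMulK_add, Functor.map_add]
    exact (congrArg (· ≫ f) h).trans (Preadditive.add_comp _ _ _ _ _ _)
  zero_smul f := by
    have h : DerivedCategory.Q.map (rightMulK u 0) = 0 := by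
      have h' : rightMulK u 0 = 0 := by simpa using rightMulK_add u 0 0
      rw [h', Functor.map_zero]
    exact (congrArg (· ≫ f) h).trans Limits.zero_comp

/-- The set `Hom(K, B[n])` is small: it is computed by an injective resolution of `B`. -/
instance (n : ℤ) (B : ModuleCat.{v} R) : Small.{v} (HomKShift u n B) := by
  let I := InjectiveResolution.of B
  have e : DerivedCategory.Q.obj (I.cochainComplex⟦n⟧) ≅
      ((DerivedCategory.singleFunctor (ModuleCat.{v} R) 0).obj B)⟦n⟧ :=
    (DerivedCategory.Q.commShiftIso n).app I.cochainComplex ≪≫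
      (shiftFunctor _ n).mapIso ((asIso (DerivedCategory.Q.map I.ι')).symm ≪≫
        ((DerivedCategory.singleFunctorIsoCompQ _ 0).app B).symm)
  have hI : (I.cochainComplex⟦n⟧).IsKInjective := inferInstance
  let F : (complexK u ⟶ I.cochainComplex⟦n⟧) → HomKShift u n B :=
    fun f => DerivedCategory.Q.map f ≫ e.hom
  suffices h : ∀ g : DerivedCategory.Q.obj (complexK u) ⟶
      ((DerivedCategory.singleFunctor (ModuleCat.{v} R) 0).obj B)⟦n⟧,
      ∃ f : complexK u ⟶ I.cochainComplex⟦n⟧, DerivedCategory.Q.map f ≫ e.hom = g from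
    small_of_surjective (f := F) h
  intro g
  let q := DerivedCategory.quotientCompQhIso (ModuleCat.{v} R)
  obtain ⟨f, hf⟩ := (CochainComplex.IsKInjective.Qh_map_bijective
    ((HomotopyCategory.quotient _ _).obj (complexK u)) (I.cochainComplex⟦n⟧)).surjective
    (q.hom.app _ ≫ g ≫ e.inv ≫ q.inv.app _)
  obtain ⟨f, rfl⟩ := (HomotopyCategory.quotient _ _).map_surjective f
  refine ⟨f, ?_⟩
  have h : DerivedCategory.Q.map f = g ≫ e.inv := by
    rw [← cancel_epi (q.hom.app _), ← DerivedCategory.quotientCompQhIso_hom_naturality, hf]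
    simp [q]
  rw [h, Category.assoc, e.inv_hom_id, Category.comp_id]

/-- The map `Hom(K, B[n]) → Hom(K, B'[n])` induced by a map `B → B'`. -/
def HomKShift.map (n : ℤ) {B B' : ModuleCat.{v} R} (f : B ⟶ B') :
    HomKShift u n B →ₗ[R] HomKShift u n B' where
  toFun g := g ≫ ((DerivedCategory.singleFunctor (ModuleCat.{v} R) 0).map f)⟦n⟧'
  map_add' _ _ := Preadditive.add_comp _ _ _ _ _ _
  map_smul' _ _ := Category.assoc _ _ _

theorem HomKShift.map_id (n : ℤ) (B : ModuleCat.{v} R) :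
    HomKShift.map u n (𝟙 B) = LinearMap.id := by
  apply LinearMap.ext
  intro g
  have h : ((DerivedCategory.singleFunctor (ModuleCat.{v} R) 0).map (𝟙 B))⟦n⟧' = 𝟙 _ := by
    rw [CategoryTheory.Functor.map_id, CategoryTheory.Functor.map_id]
  exact (congrArg (CategoryStruct.comp g) h).trans (Category.comp_id _)

theorem HomKShift.map_comp (n : ℤ) {B B' B'' : ModuleCat.{v} R} (f : B ⟶ B') (f' : B' ⟶ B'') :
    HomKShift.map u n (f ≫ f') = HomKShift.map u n f' ∘ₗ HomKShift.map u n f := by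
  apply LinearMap.ext
  intro g
  have h : ((DerivedCategory.singleFunctor (ModuleCat.{v} R) 0).map (f ≫ f'))⟦n⟧' =
      ((DerivedCategory.singleFunctor (ModuleCat.{v} R) 0).map f)⟦n⟧' ≫
        ((DerivedCategory.singleFunctor (ModuleCat.{v} R) 0).map f')⟦n⟧' := by
    rw [Functor.map_comp, Functor.map_comp]
  exact (congrArg (CategoryStruct.comp g) h).trans (Category.assoc _ _ _).symm

end Ext

/-- The functor `Ext^n_R(K, -) = Hom(K, -[n])`, with values in left `R`-modules. -/
def extK (n : ℤ) : ModuleCat.{v} R ⥤ ModuleCat.{v} R where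
  obj B := ModuleCat.of R (Shrink.{v} (HomKShift u n B))
  map f := ModuleCat.ofHom
    ((Shrink.linearEquiv R _).symm.toLinearMap ∘ₗ HomKShift.map u n f ∘ₗ
      (Shrink.linearEquiv R _).toLinearMap)
  map_id B := by
    ext x
    simp [HomKShift.map_id]
  map_comp f g := by
    ext x
    simp [HomKShift.map_comp]

/-! ### Classes of modules -/

/-- `M` is a left `u`-comodule: `U ⊗_R M = 0 = Tor_1^R(U, M)`. -/
def IsComodule (M : ModuleCat.{v} R) : Prop :=
  IsZero ((tensorU u).obj M) ∧ IsZero ((torU u 1).obj M)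

/-- `C` is a left `u`-contramodule: `Hom_R(U, C) = 0 = Ext^1_R(U, C)`. -/
def IsContramodule (C : ModuleCat.{v} R) : Prop :=
  Subsingleton (leftU u ⟶ C) ∧ Subsingleton (Abelian.Ext.{v} (leftU u) C 1)

/-- `A` is `u`-special: the map `A → U ⊗_R A`, `a ↦ 1 ⊗ a`, is surjective. -/
def IsSpecial (A : ModuleCat.{v} R) : Prop :=
  Function.Surjective ((unitMap u).app A)

/-- `B` is `u`-cospecial: the map `Hom_R(U, B) → B`, `f ↦ f 1`, is injective. -/
def IsCospecial (B : ModuleCat.{v} R) : Prop :=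
  Function.Injective fun f : leftU u ⟶ B => f.hom (1 : U)

/-- The class of `u`-cospecial left `u`-comodules. -/
def cospecialComodules : ObjectProperty (ModuleCat.{v} R) :=
  fun M => IsCospecial u M ∧ IsComodule u M

/-- The class of `u`-special left `u`-contramodules. -/
def specialContramodules : ObjectProperty (ModuleCat.{v} R) :=
  fun C => IsSpecial u C ∧ IsContramodule u C

end

end Matlis

/-!
Write `F = Ext^1(K, -)` and `G = Tor_1(K, -)`. The connecting map `K → R[1]` induces natural maps
`X → F X` (`toExtK`) and `G X → X` (`fromTorK`). The long exact sequences of the triangle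
`R → U → K → R[1]` show that the first one is an isomorphism when `X` is a contramodule, and the
second one when `X` is a comodule (`isIso_toExtK_app`, `isIso_fromTorK_app`).

Because `u` is a ring epimorphism and `Tor_1(U, U)` and `Tor_2(U, U)` vanish, every `U`-module `V`
satisfies `U ⊗_R V = V`, `Tor_i(U, V) = 0` (`isLocal_res`) and `Ext^i(U, V) = 0` for `i = 1, 2`
(`subsingleton_ext_one_leftU`, `subsingleton_ext_two_leftU`). Hence `F` and `G` both invert
every injection whose cokernel is a `U`-module and every surjection whose kernel is a `U`-module
(`isInverted_of_shortExact_f`, `isInverted_of_shortExact_g`).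

Such maps connect the two classes of modules.
* Let `M` be a cospecial comodule. Embed `M` in an injective module `I`, with cokernel `Z`, and let
  `T` be the fibre product of `I` and `Hom(U, Z)` over `Z`. Then `T / M = Hom(U, Z)`, the module
  `Hom(U, I)` embeds in `T`, and the quotient `C = T / Hom(U, I)` is a special contramodule
  (`exists_specialContramodule`).
* Let `C` be a special contramodule. Write `C` as a quotient of a free module `F₀` by `Y`, and let
  `T` be the amalgamated sum of `F₀` and `U ⊗ Y` over `Y`. Then `T / (U ⊗ Y) = C`, the module `T`
  surjects onto `U ⊗ F₀`, and the kernel `M` of this map is a cospecial comodule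
  (`exists_cospecialComodule`).

In both cases there are maps `M → T → C` which `F` and `G` invert. So `F M ≅ F C ≅ C` in the first
case and `G C ≅ G M ≅ M` in the second one, which gives the values of the functors. Naturality along
these maps shows moreover that `G` inverts `M → F M` and that `F` inverts `G C → C`, whence
isomorphisms `M ≅ G M ≅ G (F M)` and `F (G C) ≅ F C ≅ C`.
-/

namespace Matlis

noncomputable section

variable {R U : Type v} [Ring R] [Ring U] (u : R →+* U)

/-! ### Extension of scalars as a left adjoint -/

section Tensor

variable {M : Type v} [AddCommGroup M] [Module R M]

theorem smul_tmul (w v : U) (m : M) : w • tmul u v m = tmul u (w * v) m := by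
  rw [tmul, tmul, ← map_smul, TensorProduct.smul_tmul', smul_eq_mul]

theorem tmul_induction {p : BaseChange u M → Prop} (t : BaseChange u M)
    (h : ∀ v m, p (tmul u v m)) (h_add : ∀ x y, p x → p y → p (x + y)) : p t := by
  obtain ⟨t, rfl⟩ := (tensorRel u M).mkQ_surjective t
  induction t with
  | zero => simpa [tmul] using h 0 0
  | tmul v m => exact h v m
  | add x y hx hy => rw [map_add]; exact h_add _ _ hx hy

end Tensor

/-- The category of left `U`-modules viewed inside left `R`-modules. -/
abbrev res : ModuleCat.{v} U ⥤ ModuleCat.{v} R := ModuleCat.restrictScalars u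

/-- The action map `U ⊗_R V → V`, `w ⊗ x ↦ w x`, for a left `U`-module `V`. -/
def actMap (V : ModuleCat.{v} U) : BaseChange u ((res u).obj V) →ₗ[U] V :=
  Submodule.liftQ _
    (TensorProduct.AlgebraTensorModule.lift
      { toFun := fun w : U => (DistribSMul.toAddMonoidHom V w).toIntLinearMap
        map_add' := fun v w => by ext x; exact add_smul v w (show V from x)
        map_smul' := fun v w => by ext x; exact mul_smul v w (show V from x) })
    (by
      rw [tensorRel, Submodule.span_le]
      rintro _ ⟨v, r, m, rfl⟩
      refine LinearMap.mem_ker.mpr ?_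
      rw [map_sub]
      exact sub_eq_zero_of_eq (mul_smul v (u r) (show V from m)))

theorem actMap_tmul (V : ModuleCat.{v} U) (w : U) (x : V) :
    actMap u V (tmul u w (show (res u).obj V from x)) = w • x := rfl

/-- The functor `U ⊗_R -` is left adjoint to the restriction of scalars. -/
def baseChangeAdj : baseChange u ⊣ res u :=
  Adjunction.mkOfUnitCounit
    { unit := unitMap u
      counit :=
        { app := fun V => ModuleCat.ofHom (actMap u V)
          naturality := fun V W f => by
            apply ModuleCat.hom_ext
            apply baseChange_hom_ext
            intro x
            have h (X : ModuleCat.{v} U) (y : X) : (1 : U) • y = y := one_smul U y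
            exact (h W (f.hom x)).trans (congrArg f.hom (h V x)).symm }
      left_triangle := by
        apply NatTrans.ext
        funext M
        apply ModuleCat.hom_ext
        apply baseChange_hom_ext
        intro m
        exact one_smul U (tmul u 1 m)
      right_triangle := by
        ext V x
        exact one_smul U (show (V : Type v) from x) }

instance : PreservesColimits (baseChange u) := (baseChangeAdj u).leftAdjoint_preservesColimits

instance : PreservesFiniteColimits (tensorU u) := by
  unfold tensorU
  infer_instance

section RingEpi

variable {u} (hu : IsRingEpi u)
include hu

/-- The relation which makes `U`-module structures a property of `R`-modules: the scalars of `U`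
move through the tensor product `U ⊗_R V`. -/
theorem tmul_eq_one_tmul (V : ModuleCat.{v} U) (w : U) (x : V) :
    tmul u w (show (res u).obj V from x) = tmul u 1 (show (res u).obj V from w • x) := by
  have h : tmul u w (show leftU u from (1 : U)) = tmul u 1 (show leftU u from w) := by
    apply hu.injective
    exact (mul_one w).trans (one_mul w).symm
  let g : leftU u ⟶ (res u).obj V := (res u).map (ModuleCat.ofHom (LinearMap.toSpanSingleton U V x))
  have hg := congrArg (baseChangeMap u g.hom) h
  rw [baseChangeMap_tmul, baseChangeMap_tmul] at hg
  exact (congrArg (fun y : (res u).obj V => tmul u w y) (one_smul U x).symm).trans hg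

theorem unitMap_bijective (V : ModuleCat.{v} U) :
    Function.Bijective ((unitMap u).app ((res u).obj V)) := by
  constructor
  · apply Function.LeftInverse.injective (g := actMap u V)
    intro x
    exact (actMap_tmul u V 1 x).trans (one_smul U _)
  · intro t
    induction t using tmul_induction with
    | h w x => exact ⟨w • (show V from x), (tmul_eq_one_tmul hu V w x).symm⟩
    | h_add x y hx hy =>
      obtain ⟨a, rfl⟩ := hx
      obtain ⟨b, rfl⟩ := hy
      exact ⟨a + b, tmul_add u 1 a b⟩

theorem isIso_unitMap (V : ModuleCat.{v} U) : IsIso ((unitMap u).app ((res u).obj V)) := by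
  rw [ConcreteCategory.isIso_iff_bijective]
  exact unitMap_bijective hu V

/-- An `R`-linear map between `U`-modules is `U`-linear. -/
theorem map_smul_of_isRingEpi {V W : ModuleCat.{v} U} (f : (res u).obj V ⟶ (res u).obj W)
    (w : U) (x : V) :
    f.hom (show (res u).obj V from w • x) = (w • (show W from f.hom x) : W) := by
  have h := congrArg (baseChangeMap u f.hom) (tmul_eq_one_tmul hu V w x)
  rw [baseChangeMap_tmul, baseChangeMap_tmul] at h
  have h' := congrArg (actMap u W) h
  erw [actMap_tmul, actMap_tmul] at h'
  exact ((one_smul U _).symm.trans h'.symm)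

end RingEpi

/-! ### Projective resolutions -/

section Resolution

open HomologicalComplex

section LeftResolution

open Abelian

variable {A C : Type*} [Category* C] [Category* A] {ι : C ⥤ A} (Λ : LeftResolution ι)
  [ι.Full] [ι.Faithful] [HasZeroMorphisms C] [Abelian A]

/-- The augmentation in degree `0` of the functorial left resolution of `X`. -/
def augZero (X : A) : ι.obj ((Λ.chainComplex X).X 0) ⟶ X :=
  ι.map (Λ.chainComplexXZeroIso X).hom ≫ Λ.π.app X

instance (X : A) : Epi (augZero Λ X) := by
  unfold augZero
  infer_instance

theorem d_comp_augZero (X : A) : ι.map ((Λ.chainComplex X).d 1 0) ≫ augZero Λ X = 0 := by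
  rw [augZero, Λ.map_chainComplex_d_1_0]
  simp only [Category.assoc]
  rw [← ι.map_comp_assoc, Iso.inv_hom_id, ι.map_id, Category.id_comp, kernel.condition, comp_zero,
    comp_zero]

theorem exact_augZero (X : A) :
    (ShortComplex.mk _ _ (d_comp_augZero Λ X)).Exact := by
  let α : ShortComplex.mk _ _ (d_comp_augZero Λ X) ⟶
      ShortComplex.mk (kernel.ι (Λ.π.app X)) (Λ.π.app X) (kernel.condition _) :=
    { τ₁ := ι.map (Λ.chainComplexXOneIso X).hom ≫ Λ.π.app (kernel (Λ.π.app X))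
      τ₂ := ι.map (Λ.chainComplexXZeroIso X).hom
      τ₃ := 𝟙 X
      comm₁₂ := by
        have h : ι.map ((Λ.chainComplex X).d 1 0) ≫ ι.map (Λ.chainComplexXZeroIso X).hom =
            (ι.map (Λ.chainComplexXOneIso X).hom ≫ Λ.π.app (kernel (Λ.π.app X))) ≫
              kernel.ι (Λ.π.app X) := by
          rw [Λ.map_chainComplex_d_1_0]
          simp only [Category.assoc]
          rw [← ι.map_comp, Iso.inv_hom_id, ι.map_id]
          erw [Category.comp_id]
        exact h.symm
      comm₂₃ := (Category.comp_id _).symm }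
  have : Epi α.τ₁ := epi_comp _ _
  have : IsIso α.τ₂ := inferInstanceAs (IsIso (ι.map (Λ.chainComplexXZeroIso X).hom))
  have : Mono α.τ₃ := inferInstanceAs (Mono (𝟙 X))
  rw [ShortComplex.exact_iff_of_epi_of_isIso_of_mono α]
  exact ShortComplex.exact_of_f_is_kernel _ (kernelIsKernel _)

theorem augZero_naturality {X Y : A} (f : X ⟶ Y) :
    ι.map ((Λ.chainComplexMap f).f 0) ≫ augZero Λ Y = augZero Λ X ≫ f := by
  simp only [augZero, LeftResolution.chainComplexMap_f_0, Functor.map_comp, Category.assoc]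
  rw [← ι.map_comp_assoc (Iso.inv _), Iso.inv_hom_id, ι.map_id, Category.id_comp,
    Λ.π_naturality]

end LeftResolution

/-- The augmentation of the canonical free resolution, on the level of chain complexes. -/
def freePi (X : ModuleCat.{v} R) :
    ((ObjectProperty.ι (isProjective (ModuleCat.{v} R))).mapHomologicalComplex _).obj
      ((ModuleCat.projectiveResolution R).chainComplex X) ⟶ (ChainComplex.single₀ _).obj X :=
  (ChainComplex.toSingle₀Equiv _ _).symm
    ⟨augZero (ModuleCat.projectiveResolution R) X,
      d_comp_augZero (ModuleCat.projectiveResolution R) X⟩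

theorem freePi_f_zero (X : ModuleCat.{v} R) :
    (freePi X).f 0 = augZero (ModuleCat.projectiveResolution R) X :=
  ChainComplex.toSingle₀Equiv_symm_apply_f_zero _ _

/-- The augmentation of the canonical free resolution makes it a projective resolution. -/
def freeRes (X : ModuleCat.{v} R) : ProjectiveResolution X where
  complex := ((ObjectProperty.ι (isProjective (ModuleCat.{v} R))).mapHomologicalComplex _).obj
    ((ModuleCat.projectiveResolution R).chainComplex X)
  projective n := (((ModuleCat.projectiveResolution R).chainComplex X).X n).property
  π := freePi X
  quasiIso := ⟨fun n => by
    cases n with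
    | zero =>
      rw [ChainComplex.quasiIsoAt₀_iff, ShortComplex.quasiIso_iff_of_zeros']
      · refine (ShortComplex.exact_and_epi_g_iff_of_iso ?_).2
          ⟨exact_augZero (ModuleCat.projectiveResolution R) X, inferInstanceAs (Epi (augZero _ X))⟩
        exact ShortComplex.isoMk (Iso.refl _) (Iso.refl _) (Iso.refl _)
          ((Category.id_comp _).trans (Category.comp_id _).symm)
          (by
            refine (Category.id_comp _).trans (Eq.trans ?_ (Category.comp_id _).symm)
            exact (freePi_f_zero X).symm)
      · have h (K : ChainComplex (ModuleCat.{v} R) ℕ) : K.d 0 0 = 0 := K.shape 0 0 (by simp)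
        exact h (((ObjectProperty.ι (isProjective (ModuleCat.{v} R))).mapHomologicalComplex _).obj
          ((ModuleCat.projectiveResolution R).chainComplex X))
      all_goals rfl
    | succ n =>
      rw [quasiIsoAt_iff_exactAt']
      · exact (ModuleCat.projectiveResolution R).exactAt_map_chainComplex_succ X n
      · apply ChainComplex.exactAt_succ_single_obj⟩

/-- The map of canonical free resolutions induced by a map of modules. -/
def freeResHom {X Y : ModuleCat.{v} R} (f : X ⟶ Y) :
    ProjectiveResolution.Hom (freeRes X) (freeRes Y) f where
  hom := ((ObjectProperty.ι (isProjective (ModuleCat.{v} R))).mapHomologicalComplex _).map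
    ((ModuleCat.projectiveResolution R).chainComplexMap f)
  hom_f_zero_comp_π_f_zero := by
    change _ ≫ (freePi Y).f 0 = (freePi X).f 0 ≫ _
    rw [freePi_f_zero, freePi_f_zero]
    exact augZero_naturality (ModuleCat.projectiveResolution R) f

/-- The augmentation of the canonical free resolution. -/
def freeAug : freeResolution R ⟶ CochainComplex.singleFunctor (ModuleCat.{v} R) 0 where
  app X := (freeRes X).π'
  naturality _ _ f := (freeResHom f).hom'_comp_π'

instance (X : ModuleCat.{v} R) : QuasiIso (freeAug.app X) :=
  inferInstanceAs (QuasiIso (freeRes X).π')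

instance (X : ModuleCat.{v} R) : ((freeResolution R).obj X).IsKProjective :=
  inferInstanceAs (freeRes X).cochainComplex.IsKProjective

instance (X : ModuleCat.{v} R) : ((freeResolution R).obj X).IsStrictlyLE 0 :=
  inferInstanceAs ((freeRes X).cochainComplex.IsStrictlyLE 0)

variable {C D : Type*} [Category* C] [Abelian C] [Category* D] [Abelian D]
  (F : C ⥤ D) [F.Additive]

/-- The cohomology of the image of a projective resolution in the negative degree `-(n + 1)` is the
left derived functor of degree `n + 1`. -/
theorem exactAt_map_cochainComplex_iff [HasProjectiveResolutions C] {X : C}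
    (P : ProjectiveResolution X) (n : ℕ) (m : ℤ) (hm : m = -((n + 1 : ℕ) : ℤ)) :
    ((F.mapHomologicalComplex (ComplexShape.up ℤ)).obj P.cochainComplex).ExactAt m ↔
      IsZero ((F.leftDerived (n + 1)).obj X) := by
  rw [(P.isoLeftDerivedObj F (n + 1)).isZero_iff]
  change _ ↔ IsZero (((F.mapHomologicalComplex _).obj P.complex).homology (n + 1))
  rw [← exactAt_iff_isZero_homology,
    exactAt_iff' _ (n + 1 + 1) (n + 1) n (ComplexShape.prev_eq' _ rfl)
      (ComplexShape.next_eq' _ rfl),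
    exactAt_iff' _ (m - 1) m (m + 1) (by simp) (by simp)]
  refine ShortComplex.exact_iff_of_iso (ShortComplex.isoMk
    (F.mapIso (P.cochainComplexXIso (m - 1) (n + 1 + 1) (by grind)))
    (F.mapIso (P.cochainComplexXIso m (n + 1) (by grind)))
    (F.mapIso (P.cochainComplexXIso (m + 1) n (by grind))) ?_ ?_)
  · change F.map _ ≫ F.map _ = F.map _ ≫ F.map _
    rw [← F.map_comp, ← F.map_comp,
      P.cochainComplex_d (m - 1) m (n + 1 + 1) (n + 1) (by grind) (by grind)]
    simp
  · change F.map _ ≫ F.map _ = F.map _ ≫ F.map _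
    rw [← F.map_comp, ← F.map_comp,
      P.cochainComplex_d m (m + 1) (n + 1) n (by grind) (by grind)]
    simp

/-- A right exact functor takes the augmentation of a projective resolution to a map which is an
isomorphism on cohomology in degree `0`. -/
theorem quasiIsoAt_map_π' [PreservesFiniteColimits F] {X : C} (P : ProjectiveResolution X) :
    QuasiIsoAt ((F.mapHomologicalComplex (ComplexShape.up ℤ)).map P.π') 0 := by
  rw [quasiIsoAt_iff' _ (-1) 0 1 (by simp) (by simp), ShortComplex.quasiIso_iff_of_zeros']
  · have hP : (ShortComplex.mk (F.map (P.complex.d 1 0)) (F.map (P.π.f 0)) (by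
        rw [← F.map_comp, P.complex_d_comp_π_f_zero, F.map_zero])).Exact ∧
          Epi (F.map (P.π.f 0)) := by
      have := (ShortComplex.exact_and_epi_g_iff_g_is_cokernel
        (ShortComplex.mk (F.map (P.complex.d 1 0)) (F.map (P.π.f 0)) (by
          rw [← F.map_comp, P.complex_d_comp_π_f_zero, F.map_zero]))).2
        ⟨CokernelCofork.mapIsColimit _ P.isColimitCokernelCofork F⟩
      exact this
    refine (ShortComplex.exact_and_epi_g_iff_of_iso ?_).2 hP
    refine ShortComplex.isoMk (F.mapIso (P.cochainComplexXIso (-1) 1 (by lia)))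
      (F.mapIso (P.cochainComplexXIso 0 0 (by lia)))
      (F.mapIso (HomologicalComplex.singleObjXSelf (.up ℤ) 0 X)) ?_ ?_
    · change F.map _ ≫ F.map _ = F.map _ ≫ F.map _
      rw [← F.map_comp, ← F.map_comp, P.cochainComplex_d (-1) 0 1 0 (by lia) (by lia)]
      simp
    · change F.map _ ≫ F.map _ = F.map _ ≫ F.map _
      rw [← F.map_comp, ← F.map_comp, P.π'_f_zero]
      congr 1
      have h {A B X Y : C} (a : A ⟶ B) (b : B ⟶ X) (e : Y ≅ X) :
          a ≫ b = (a ≫ b ≫ e.inv) ≫ e.hom := by simp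
      exact h _ _ _
  · exact (F.map_isZero (CochainComplex.isZero_of_isStrictlyLE _ 0 1)).eq_of_tgt _ _
  · exact (F.map_isZero (HomologicalComplex.isZero_single_obj_X _ _ _ _ (by lia))).eq_of_src _ _
  · exact (F.map_isZero (HomologicalComplex.isZero_single_obj_X _ _ _ _ (by lia))).eq_of_tgt _ _
end Resolution

/-! ### Resolutions of short exact sequences -/

section Triangles

open Pretriangulated

variable (R) in
/-- The homotopy category of complexes of left `R`-modules. -/
abbrev HoCat : Type _ := HomotopyCategory (ModuleCat.{v} R) (ComplexShape.up ℤ)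

variable (R) in
/-- The canonical free resolution, as a functor to the homotopy category. -/
def resolve : ModuleCat.{v} R ⥤ HoCat R :=
  freeResolution R ⋙ HomotopyCategory.quotient _ _

variable (R) in
/-- The objects of the homotopy category having no nonzero morphisms to acyclic complexes. -/
abbrev kProj : ObjectProperty (HoCat R) :=
  (HomotopyCategory.subcategoryAcyclic (ModuleCat.{v} R)).leftOrthogonal

theorem kProj_resolve (X : ModuleCat.{v} R) : kProj R ((resolve R).obj X) :=
  CochainComplex.IsKProjective.leftOrthogonal ((freeResolution R).obj X)

attribute [local instance] HasDerivedCategory.standard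

theorem Qh_map_bijective {Z : HoCat R} (hZ : kProj R Z) (L : HoCat R) :
    Function.Bijective (DerivedCategory.Qh.map : (Z ⟶ L) → _) :=
  hZ.map_bijective_of_isTriangulated _ _

/-- An isomorphism in the derived category between K-projective complexes comes from a homotopy
equivalence. -/
theorem exists_iso_of_Qh_iso {Y Z : HoCat R} (hY : kProj R Y) (hZ : kProj R Z)
    (e : DerivedCategory.Qh.obj Y ≅ DerivedCategory.Qh.obj Z) :
    ∃ f : Y ≅ Z, DerivedCategory.Qh.map f.hom = e.hom := by
  obtain ⟨f, hf⟩ := (Qh_map_bijective hY Z).surjective e.hom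
  obtain ⟨g, hg⟩ := (Qh_map_bijective hZ Y).surjective e.inv
  refine ⟨⟨f, g, (Qh_map_bijective hY Y).injective ?_, (Qh_map_bijective hZ Z).injective ?_⟩, hf⟩
  · rw [Functor.map_comp, hf, hg, e.hom_inv_id, CategoryTheory.Functor.map_id]
  · rw [Functor.map_comp, hf, hg, e.inv_hom_id, CategoryTheory.Functor.map_id]

variable (R) in
/-- In the derived category, the canonical free resolution of a module is that module. -/
def resolveIso :
    resolve R ⋙ DerivedCategory.Qh ≅ DerivedCategory.singleFunctor (ModuleCat.{v} R) 0 :=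
  have : IsIso (Functor.whiskerRight freeAug (DerivedCategory.Q (C := ModuleCat.{v} R))) :=
    have (X : ModuleCat.{v} R) :
        IsIso ((Functor.whiskerRight freeAug DerivedCategory.Q).app X) :=
      inferInstanceAs (IsIso (DerivedCategory.Q.map (freeAug.app X)))
    NatIso.isIso_of_isIso_app _
  Functor.associator _ _ _ ≪≫
    Functor.isoWhiskerLeft (freeResolution R) (DerivedCategory.quotientCompQhIso _) ≪≫
    asIso (Functor.whiskerRight freeAug DerivedCategory.Q) ≪≫
    (DerivedCategory.singleFunctorIsoCompQ (ModuleCat.{v} R) 0).symm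

/-- The canonical free resolutions of the terms of a short exact sequence form a distinguished
triangle in the homotopy category. -/
theorem exists_resolve_distinguished {S : ShortComplex (ModuleCat.{v} R)} (hS : S.ShortExact) :
    ∃ δ : (resolve R).obj S.X₃ ⟶ ((resolve R).obj S.X₁)⟦(1 : ℤ)⟧,
      Triangle.mk ((resolve R).map S.f) ((resolve R).map S.g) δ ∈ distTriang (HoCat R) := by
  obtain ⟨Z, g, h, hT⟩ := distinguished_cocone_triangle ((resolve R).map S.f)
  have hZ : kProj R Z := (kProj R).ext_of_isTriangulatedClosed₃ _ hT (kProj_resolve _)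
    (kProj_resolve _)
  have hT' := DerivedCategory.Qh.map_distinguished _ hT
  obtain ⟨c, hc₁, hc₂⟩ : ∃ c : DerivedCategory.Qh.obj Z ⟶
      (DerivedCategory.singleFunctor (ModuleCat.{v} R) 0).obj S.X₃, _ :=
    complete_distinguished_triangle_morphism _ _ hT' hS.singleTriangle_distinguished
      ((resolveIso R).hom.app S.X₁) ((resolveIso R).hom.app S.X₂)
    ((resolveIso R).hom.naturality S.f)
  let φ : DerivedCategory.Qh.mapTriangle.obj (Triangle.mk ((resolve R).map S.f) g h) ⟶
      hS.singleTriangle :=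
    { hom₁ := (resolveIso R).hom.app S.X₁
      hom₂ := (resolveIso R).hom.app S.X₂
      hom₃ := c
      comm₁ := (resolveIso R).hom.naturality S.f
      comm₂ := hc₁
      comm₃ := hc₂ }
  have hφ : IsIso c := isIso₃_of_isIso₁₂ φ hT' hS.singleTriangle_distinguished
    (inferInstanceAs (IsIso ((resolveIso R).hom.app S.X₁)))
    (inferInstanceAs (IsIso ((resolveIso R).hom.app S.X₂)))
  obtain ⟨e, he⟩ := exists_iso_of_Qh_iso hZ (kProj_resolve S.X₃)
    (asIso c ≪≫ ((resolveIso R).app S.X₃).symm)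
  refine ⟨e.inv ≫ h, isomorphic_distinguished _ hT _ ?_⟩
  refine Triangle.isoMk _ _ (Iso.refl _) (Iso.refl _) e.symm ?_ ?_ ?_
  · exact (Category.comp_id _).trans (Category.id_comp _).symm
  · refine Eq.trans ?_ (Category.id_comp _).symm
    change (resolve R).map S.g ≫ e.inv = g
    rw [Iso.comp_inv_eq]
    apply (Qh_map_bijective (kProj_resolve S.X₂) _).injective
    rw [Functor.map_comp, he]
    change DerivedCategory.Qh.map g ≫ c = _ at hc₁
    change _ = DerivedCategory.Qh.map g ≫ c ≫ (resolveIso R).inv.app S.X₃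
    rw [reassoc_of% hc₁]
    exact (NatIso.naturality_2 (resolveIso R) S.g).symm.trans (Category.assoc _ _ _).symm
  · change (e.inv ≫ h) ≫ (𝟙 _)⟦(1 : ℤ)⟧' = e.inv ≫ h
    rw [CategoryTheory.Functor.map_id, Category.comp_id]

/-- The functors `Tor^R_{-n}(U, -)`, computed by the canonical free resolution of the argument. -/
def torH (n : ℤ) : ModuleCat.{v} R ⥤ ModuleCat.{v} R :=
  resolve R ⋙ (tensorU u).mapHomotopyCategory _ ⋙ HomotopyCategory.homologyFunctor _ _ n

/-- The complex `U ⊗_R P`, where `P` is the canonical free resolution. -/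
abbrev tensorRes (X : ModuleCat.{v} R) : CochainComplex (ModuleCat.{v} R) ℤ :=
  ((tensorU u).mapHomologicalComplex (ComplexShape.up ℤ)).obj ((freeResolution R).obj X)

theorem isZero_torH_iff (X : ModuleCat.{v} R) (n : ℕ) (m : ℤ) (hm : m = -((n + 1 : ℕ) : ℤ)) :
    IsZero ((torH u m).obj X) ↔ IsZero ((torU u (n + 1)).obj X) := by
  rw [torU, ← exactAt_map_cochainComplex_iff (tensorU u) (freeRes X) n m hm,
    HomologicalComplex.exactAt_iff_isZero_homology]
  exact ((HomotopyCategory.homologyFunctorFactors _ _ m).app (tensorRes u X)).isZero_iff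

theorem isZero_torH_of_pos (X : ModuleCat.{v} R) (m : ℤ) (hm : 0 < m) :
    IsZero ((torH u m).obj X) := by
  refine IsZero.of_iso ?_ ((HomotopyCategory.homologyFunctorFactors _ _ m).app (tensorRes u X))
  refine (HomologicalComplex.exactAt_iff_isZero_homology _ _).1 ?_
  refine ShortComplex.exact_of_isZero_X₂ _ ((tensorU u).map_isZero ?_)
  exact CochainComplex.isZero_of_isStrictlyLE ((freeResolution R).obj X) 0 m

/-- In degree `0` the functors `torH` are the tensor product. -/
def torHZero : torH u 0 ≅ tensorU u :=
  have (X : ModuleCat.{v} R) : IsIso ((Functor.whiskerRight (freeAug (R := R))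
      ((tensorU u).mapHomologicalComplex (ComplexShape.up ℤ) ⋙
        HomologicalComplex.homologyFunctor _ _ 0)).app X) :=
    (quasiIsoAt_iff_isIso_homologyMap _ _).1 (quasiIsoAt_map_π' (tensorU u) (freeRes X))
  have := NatIso.isIso_of_isIso_app (Functor.whiskerRight (freeAug (R := R))
      ((tensorU u).mapHomologicalComplex (ComplexShape.up ℤ) ⋙
        HomologicalComplex.homologyFunctor _ _ 0))
  show freeResolution R ⋙ (tensorU u).mapHomologicalComplex (ComplexShape.up ℤ) ⋙
      HomotopyCategory.quotient _ _ ⋙ HomotopyCategory.homologyFunctor _ _ 0 ≅ tensorU u from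
  Functor.isoWhiskerLeft (freeResolution R)
      (Functor.isoWhiskerLeft ((tensorU u).mapHomologicalComplex (ComplexShape.up ℤ))
        (HomotopyCategory.homologyFunctorFactors _ _ 0)) ≪≫
    asIso (Functor.whiskerRight (freeAug (R := R))
      ((tensorU u).mapHomologicalComplex (ComplexShape.up ℤ) ⋙
        HomologicalComplex.homologyFunctor _ _ 0)) ≪≫
    Functor.isoWhiskerRight (HomologicalComplex.singleMapHomologicalComplex (tensorU u) _ 0)
      (HomologicalComplex.homologyFunctor _ _ 0) ≪≫
    Functor.isoWhiskerLeft (tensorU u)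
      (HomologicalComplex.homologyFunctorSingleIso (ModuleCat.{v} R) (ComplexShape.up ℤ) 0)

variable (R) in
/-- The cohomology functors on the homotopy category. -/
abbrev coh (n : ℤ) : HoCat R ⥤ ModuleCat.{v} R :=
  HomotopyCategory.homologyFunctor (ModuleCat.{v} R) (ComplexShape.up ℤ) n

/-- The long exact cohomology sequence of a distinguished triangle in the homotopy category. -/
theorem coh_exact (T : Triangle (HoCat R)) (hT : T ∈ distTriang (HoCat R)) (n : ℤ) :
    ∃ δ : (coh R n).obj T.obj₃ ⟶ (coh R (n + 1)).obj T.obj₁,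
      (∃ w, (ShortComplex.mk ((coh R n).map T.mor₁) ((coh R n).map T.mor₂) w).Exact) ∧
      (∃ w, (ShortComplex.mk ((coh R n).map T.mor₂) δ w).Exact) ∧
      ∃ w, (ShortComplex.mk δ ((coh R (n + 1)).map T.mor₁) w).Exact :=
  ⟨(coh R 0).homologySequenceδ T n (n + 1) rfl,
    ⟨_, (coh R 0).homologySequence_exact₂ T hT n⟩,
    ⟨_, (coh R 0).homologySequence_exact₃ T hT n (n + 1) rfl⟩,
    ⟨_, (coh R 0).homologySequence_exact₁ T hT n (n + 1) rfl⟩⟩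

section LongExact

variable {S : ShortComplex (ModuleCat.{v} R)} (hS : S.ShortExact)
include hS

/-- The long exact sequence of `torH` of a short exact sequence, in the form of the three
exactness statements around each connecting map. -/
theorem torH_exact (n : ℤ) :
    ∃ δ : (torH u n).obj S.X₃ ⟶ (torH u (n + 1)).obj S.X₁,
      (∃ w, (ShortComplex.mk ((torH u n).map S.f) ((torH u n).map S.g) w).Exact) ∧
      (∃ w, (ShortComplex.mk ((torH u n).map S.g) δ w).Exact) ∧
      ∃ w, (ShortComplex.mk δ ((torH u (n + 1)).map S.f) w).Exact := by
  obtain ⟨δ, hT⟩ := exists_resolve_distinguished hS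
  have hT' := ((tensorU u).mapHomotopyCategory (ComplexShape.up ℤ)).map_distinguished _ hT
  exact coh_exact _ hT' n

theorem mono_torH_map (n m : ℤ) (hnm : n + 1 = m) (h : IsZero ((torH u n).obj S.X₃)) :
    Mono ((torH u m).map S.f) := by
  subst hnm
  obtain ⟨δ, -, -, w, hδ⟩ := torH_exact u hS n
  exact hδ.mono_g (h.eq_of_src _ _)

theorem isZero_torH_X₂ (n : ℤ) (h₁ : IsZero ((torH u n).obj S.X₁))
    (h₃ : IsZero ((torH u n).obj S.X₃)) : IsZero ((torH u n).obj S.X₂) := by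
  obtain ⟨δ, ⟨w, hδ⟩, -⟩ := torH_exact u hS n
  exact hδ.isZero_of_both_zeros (h₁.eq_of_src _ _) (h₃.eq_of_tgt _ _)

theorem isZero_torH_X₃ (n m : ℤ) (hnm : n + 1 = m) (h₂ : IsZero ((torH u n).obj S.X₂))
    (h₁ : Mono ((torH u m).map S.f)) : IsZero ((torH u n).obj S.X₃) := by
  subst hnm
  obtain ⟨δ, -, ⟨w, hδ⟩, w', hδ'⟩ := torH_exact u hS n
  refine hδ.isZero_of_both_zeros (h₂.eq_of_src _ _) ?_
  rwa [← cancel_mono ((torH u (n + 1)).map S.f), zero_comp]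

theorem isZero_torH_X₁ (n m : ℤ) (hnm : n + 1 = m) (h₃ : IsZero ((torH u n).obj S.X₃))
    (h₂ : Mono ((torH u m).map S.g)) : IsZero ((torH u m).obj S.X₁) := by
  have := mono_torH_map u hS n m hnm h₃
  obtain ⟨δ, ⟨w, -⟩, -⟩ := torH_exact u hS m
  refine (IsZero.iff_id_eq_zero _).2 ?_
  rwa [← cancel_mono ((torH u m).map S.f), ← cancel_mono ((torH u m).map S.g), zero_comp,
    zero_comp, Category.id_comp]

end LongExact

end Triangles

/-! ### The two mapping cones of a commutative square -/

section Square

open CochainComplex Pretriangulated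

variable {A B A' B' : CochainComplex (ModuleCat.{v} R) ℤ}

/-- The map on cohomology induced by a map of complexes. -/
abbrev cohMap (n : ℤ) {X Y : CochainComplex (ModuleCat.{v} R) ℤ} (f : X ⟶ Y) :
    (coh R n).obj ((HomotopyCategory.quotient _ _).obj X) ⟶
      (coh R n).obj ((HomotopyCategory.quotient _ _).obj Y) :=
  (coh R n).map ((HomotopyCategory.quotient _ _).map f)

theorem cohMap_comp (n : ℤ) {X Y Z : CochainComplex (ModuleCat.{v} R) ℤ} (f : X ⟶ Y) (g : Y ⟶ Z) :
    cohMap n (f ≫ g) = cohMap n f ≫ cohMap n g := by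
  rw [cohMap, Functor.map_comp, Functor.map_comp]

/-- The long exact sequence of the mapping cones of two composable maps and of their composite. -/
theorem coh_mappingCone_exact (f : A ⟶ B) (g : B ⟶ B') (h : A ⟶ B') (hh : f ≫ g = h) (n : ℤ) :
    ∃ δ : (coh R n).obj ((HomotopyCategory.quotient _ _).obj (mappingCone g)) ⟶
        (coh R (n + 1)).obj ((HomotopyCategory.quotient _ _).obj (mappingCone f)),
      (∃ w, (ShortComplex.mk
        (cohMap n (mappingCone.map f h (𝟙 A) g (by rw [hh, Category.id_comp])))
        (cohMap n (mappingCone.map h g f (𝟙 B') (by rw [hh, Category.comp_id]))) w).Exact) ∧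
      (∃ w, (ShortComplex.mk
        (cohMap n (mappingCone.map h g f (𝟙 B') (by rw [hh, Category.comp_id]))) δ w).Exact) ∧
      ∃ w, (ShortComplex.mk δ
        (cohMap (n + 1) (mappingCone.map f h (𝟙 A) g (by rw [hh, Category.id_comp]))) w).Exact := by
  subst hh
  exact coh_exact _ (HomotopyCategory.mappingConeCompTriangleh_distinguished f g) n

/-- Two exact sequences `Gm → A → H → G` and `F → H → B → Fp` crossing in one term `H`: if the
diagonal `F → H → G` is an isomorphism, and the corresponding diagonals through the neighbouring
terms `Hm` and `Hp` are respectively surjective and injective, then the other diagonal `A → H → B`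
is an isomorphism. -/
theorem isIso_of_crossing_exact {A B Fm F Fp H Hm Hp G Gm Gp : ModuleCat.{v} R}
    {im : Fm ⟶ Hm} {qm : Hm ⟶ Gm} {d₁ : Gm ⟶ A} {j : A ⟶ H} {q : H ⟶ G}
    {i : F ⟶ H} {p : H ⟶ B} {d₂ : B ⟶ Fp} {ip : Fp ⟶ Hp} {qp : Hp ⟶ Gp}
    (h₁ : ∃ w, (ShortComplex.mk qm d₁ w).Exact) (h₂ : ∃ w, (ShortComplex.mk d₁ j w).Exact)
    (h₃ : ∃ w, (ShortComplex.mk j q w).Exact) (h₄ : ∃ w, (ShortComplex.mk i p w).Exact)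
    (h₅ : ∃ w, (ShortComplex.mk p d₂ w).Exact) (h₆ : ∃ w, (ShortComplex.mk d₂ ip w).Exact)
    (hm : Epi (im ≫ qm)) (hi : IsIso (i ≫ q)) (hp : Mono (ip ≫ qp)) : IsIso (j ≫ p) := by
  obtain ⟨w₁, -⟩ := h₁
  obtain ⟨w₂, h₂⟩ := h₂
  obtain ⟨w₃, h₃⟩ := h₃
  obtain ⟨w₄, h₄⟩ := h₄
  obtain ⟨w₅, h₅⟩ := h₅
  obtain ⟨w₆, -⟩ := h₆
  rw [ShortComplex.moduleCat_exact_iff] at h₂ h₃ h₄ h₅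
  rw [ModuleCat.epi_iff_surjective] at hm
  rw [ModuleCat.mono_iff_injective] at hp
  rw [ConcreteCategory.isIso_iff_bijective] at hi ⊢
  have e₁ (x) : d₁ (qm x) = 0 := congrArg (fun f => f.hom x) w₁
  have e₃ (x) : q (j x) = 0 := congrArg (fun f => f.hom x) w₃
  have e₄ (x) : p (i x) = 0 := congrArg (fun f => f.hom x) w₄
  have e₆ (x) : ip (d₂ x) = 0 := congrArg (fun f => f.hom x) w₆
  constructor
  · refine (injective_iff_map_eq_zero (j ≫ p).hom).2 fun x hx => ?_
    obtain ⟨z, hz⟩ := h₄ (j x) hx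
    change i z = j x at hz
    have hz0 : z = 0 := by
      apply hi.injective
      change q (i z) = (i ≫ q) 0
      rw [hz, e₃, map_zero]
    rw [hz0, map_zero] at hz
    obtain ⟨w, hw⟩ := h₂ x hz.symm
    change d₁ w = x at hw
    obtain ⟨y, hy⟩ := hm w
    change qm (im y) = w at hy
    rw [← hw, ← hy, e₁]
  · intro y
    have hy : d₂ y = 0 := by
      apply hp
      change qp (ip (d₂ y)) = (ip ≫ qp) 0
      rw [e₆, map_zero, map_zero]
    obtain ⟨h, hh⟩ := h₅ y hy
    change p h = y at hh
    obtain ⟨z, hz⟩ := hi.surjective (q h)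
    change q (i z) = q h at hz
    obtain ⟨x, hx⟩ := h₃ (h - i z) (by change q _ = 0; rw [map_sub, hz, sub_self])
    change j x = h - i z at hx
    refine ⟨x, ?_⟩
    change p (j x) = y
    rw [hx, map_sub, e₄, hh, sub_zero]

/-- In a commutative square of complexes, the map between the cones of the horizontal arrows is
an isomorphism on cohomology in a given degree as soon as the map between the cones of the
vertical arrows is so in neighbouring degrees: both cones of maps of cones are the total complex
of the square. -/
theorem isIso_cohMap_mappingCone_map (a : A ⟶ B) (a' : A' ⟶ B') (b : A ⟶ A') (b' : B ⟶ B')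
    (h : a ≫ b' = b ≫ a') (n : ℤ)
    (hk : ∀ m, n - 1 ≤ m → m ≤ n + 1 → IsIso (cohMap m (mappingCone.map b b' a a' h.symm))) :
    IsIso (cohMap n (mappingCone.map a a' b b' h)) := by
  obtain ⟨n, rfl⟩ : ∃ m, n = m + 1 := ⟨n - 1, by lia⟩
  have hk' (m : ℤ) : cohMap m (mappingCone.map b b' a a' h.symm) =
      cohMap m (mappingCone.map b (b ≫ a') (𝟙 A) a' (by rw [Category.id_comp])) ≫
        cohMap m (mappingCone.map (b ≫ a') b' a (𝟙 B') (by rw [h, Category.comp_id])) := by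
    rw [← cohMap_comp, ← mappingCone.map_comp]
    congr! 2
  have hj : cohMap (n + 1) (mappingCone.map a a' b b' h) =
      cohMap (n + 1) (mappingCone.map a (b ≫ a') (𝟙 A) b' (by rw [h, Category.id_comp])) ≫
        cohMap (n + 1) (mappingCone.map (b ≫ a') a' b (𝟙 B') (by rw [Category.comp_id])) := by
    rw [← cohMap_comp, ← mappingCone.map_comp]
    congr! 2
  obtain ⟨d₁, -, h₁, h₂⟩ := coh_mappingCone_exact a b' (b ≫ a') h n
  obtain ⟨-, h₃, -, -⟩ := coh_mappingCone_exact a b' (b ≫ a') h (n + 1)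
  obtain ⟨d₂, h₄, h₅, h₆⟩ := coh_mappingCone_exact b a' (b ≫ a') rfl (n + 1)
  rw [hj]
  simp only [hk'] at hk
  have hk₀ := hk n (by lia) (by lia)
  have hk₂ := hk (n + 1 + 1) (by lia) (by lia)
  exact isIso_of_crossing_exact h₁ h₂ h₃ h₄ h₅ h₆ (@IsIso.epi_of_iso _ _ _ _ _ hk₀)
    (hk (n + 1) (by lia) (by lia)) (@IsIso.mono_of_iso _ _ _ _ _ hk₂)

end Square

/-! ### Cohomology of `K ⊗_R -` -/

section TensorK

open CochainComplex Pretriangulated HomologicalComplex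

/-- The natural map `P → U ⊗_R P` for complexes of left `R`-modules. -/
abbrev unitC : (𝟭 (ModuleCat.{v} R)).mapHomologicalComplex (ComplexShape.up ℤ) ⟶
    (tensorU u).mapHomologicalComplex (ComplexShape.up ℤ) :=
  NatTrans.mapHomologicalComplex (unitMap u) (ComplexShape.up ℤ)

theorem inl_v_mappingCone_map {D : Type*} [Category* D] [Preadditive D] [HasBinaryBiproducts D]
    {X Y X' Y' : CochainComplex D ℤ} (φ : X ⟶ Y) (φ' : X' ⟶ Y') (a : X ⟶ X') (b : Y ⟶ Y')
    (h : φ ≫ b = a ≫ φ') (n : ℤ) :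
    (mappingCone.inl φ).v (n + 1) n (by lia) ≫ (mappingCone.map φ φ' a b h).f n =
      a.f (n + 1) ≫ (mappingCone.inl φ').v (n + 1) n (by lia) := by
  simp [mappingCone.map]

theorem inr_f_mappingCone_map {D : Type*} [Category* D] [Preadditive D] [HasBinaryBiproducts D]
    {X Y X' Y' : CochainComplex D ℤ} (φ : X ⟶ Y) (φ' : X' ⟶ Y') (a : X ⟶ X') (b : Y ⟶ Y')
    (h : φ ≫ b = a ≫ φ') (n : ℤ) :
    (mappingCone.inr φ).f n ≫ (mappingCone.map φ φ' a b h).f n =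
      b.f n ≫ (mappingCone.inr φ').f n := by
  simp [mappingCone.map]

theorem comp_add_eq_add_comp {D : Type*} [Category* D] [Preadditive D] {X X' A A' B B' Y Y' : D}
    {a : X ⟶ X'} {p : X ⟶ A} {p' : X' ⟶ A'} {q : X ⟶ B} {q' : X' ⟶ B'} {i : A ⟶ Y} {i' : A' ⟶ Y'}
    {j : B ⟶ Y} {j' : B' ⟶ Y'} {m : Y ⟶ Y'} {b : A ⟶ A'} {c : B ⟶ B'}
    (hp : p ≫ b = a ≫ p') (hi : i ≫ m = b ≫ i') (hq : q ≫ c = a ≫ q') (hj : j ≫ m = c ≫ j') :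
    a ≫ (p' ≫ i' + q' ≫ j') = (p ≫ i + q ≫ j) ≫ m := by
  rw [Preadditive.add_comp, Preadditive.comp_add, Category.assoc, Category.assoc, hi, hj,
    reassoc_of% hp, reassoc_of% hq]

/-- A natural transformation of additive functors is compatible with mapping cones. -/
theorem mapHomologicalComplex_app_mappingCone {C D : Type*} [Category* C] [Category* D]
    [Preadditive C] [Preadditive D] [HasBinaryBiproducts C] [HasBinaryBiproducts D]
    {F G : C ⥤ D} [F.Additive] [G.Additive]
    (α : F ⟶ G) {X Y : CochainComplex C ℤ} (f : X ⟶ Y) :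
    (NatTrans.mapHomologicalComplex α (ComplexShape.up ℤ)).app (mappingCone f) ≫
        (mappingCone.mapHomologicalComplexIso f G).hom =
      (mappingCone.mapHomologicalComplexIso f F).hom ≫
        mappingCone.map ((F.mapHomologicalComplex _).map f) ((G.mapHomologicalComplex _).map f)
          ((NatTrans.mapHomologicalComplex α (ComplexShape.up ℤ)).app X)
          ((NatTrans.mapHomologicalComplex α (ComplexShape.up ℤ)).app Y)
          (NatTrans.naturality _ f) := by
  ext n
  change α.app _ ≫ (mappingCone.mapHomologicalComplexXIso f G n).hom =
    (mappingCone.mapHomologicalComplexXIso f F n).hom ≫ _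
  rw [mappingCone.mapHomologicalComplexXIso_eq f F n (n + 1) rfl,
    mappingCone.mapHomologicalComplexXIso_eq f G n (n + 1) rfl]
  change α.app _ ≫ (G.map _ ≫ _ + G.map _ ≫ _) = (F.map _ ≫ _ + F.map _ ≫ _) ≫ _
  exact comp_add_eq_add_comp (b := α.app (X.X (n + 1))) (c := α.app (Y.X n)) (α.naturality _)
    (inl_v_mappingCone_map _ _ _ _ _ n) (α.naturality _) (inr_f_mappingCone_map _ _ _ _ _ n)

/-- The map `K ⊗ f` is an isomorphism on cohomology if `P → U ⊗_R P` is one for the cone `P`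
of `f`. -/
theorem isIso_cohMap_tensorK {X Y : CochainComplex (ModuleCat.{v} R) ℤ} (f : X ⟶ Y) (n : ℤ)
    (hf : ∀ m, n - 1 ≤ m → m ≤ n + 1 → IsIso (cohMap m ((unitC u).app (mappingCone f)))) :
    IsIso (cohMap n ((tensorK u).map f)) := by
  refine isIso_cohMap_mappingCone_map _ _ _ _ (NatTrans.naturality (unitC u) f).symm n
    fun m hm hm' => ?_
  have h := congrArg (cohMap m) (mapHomologicalComplex_app_mappingCone (unitMap u) f)
  rw [cohMap_comp, cohMap_comp] at h
  have := hf m hm hm'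
  have h' : cohMap m (mappingCone.map _ _ _ _ (NatTrans.naturality (unitC u) f)) =
    inv (cohMap m (mappingCone.mapHomologicalComplexIso f (𝟭 _)).hom) ≫
      cohMap m ((unitC u).app (mappingCone f)) ≫
        cohMap m (mappingCone.mapHomologicalComplexIso f (tensorU u)).hom := by
    rw [h, IsIso.inv_hom_id_assoc]
  rw [h']
  infer_instance

end TensorK

/-! ### Modules that `U ⊗_R^L -` does not change in low degrees -/

section Local

open CochainComplex Pretriangulated HomologicalComplex

theorem isIso_cohMap_iff (n : ℤ) {X Y : CochainComplex (ModuleCat.{v} R) ℤ} (f : X ⟶ Y) :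
    IsIso (cohMap n f) ↔ QuasiIsoAt f n := by
  rw [quasiIsoAt_iff_isIso_homologyMap]
  exact NatIso.isIso_map_iff (HomotopyCategory.homologyFunctorFactors (ModuleCat.{v} R)
    (ComplexShape.up ℤ) n) f

theorem quasiIsoAt_iff_of_comm {A B A' B' : CochainComplex (ModuleCat.{v} R) ℤ} {a : A ⟶ B}
    {a' : A' ⟶ B'} {b : A ⟶ A'} {b' : B ⟶ B'} (w : a ≫ b' = b ≫ a') (n : ℤ)
    (hb : QuasiIsoAt b n) (hb' : QuasiIsoAt b' n) : QuasiIsoAt a n ↔ QuasiIsoAt a' n := by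
  rw [← quasiIsoAt_iff_comp_right a b', w, quasiIsoAt_iff_comp_left]

/-- Whether `P → U ⊗_R P` is an isomorphism on cohomology in a given degree only depends on the
homotopy type of `P`. -/
theorem quasiIsoAt_unitC_of_iso {X Y : CochainComplex (ModuleCat.{v} R) ℤ}
    (e : (HomotopyCategory.quotient _ _).obj X ≅ (HomotopyCategory.quotient _ _).obj Y) (n : ℤ)
    (h : QuasiIsoAt ((unitC u).app X) n) : QuasiIsoAt ((unitC u).app Y) n := by
  rw [← isIso_cohMap_iff] at h ⊢
  obtain ⟨f, hf⟩ := (HomotopyCategory.quotient _ _).map_surjective e.hom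
  have h₁ : IsIso (cohMap n f) := by
    rw [cohMap, hf]
    infer_instance
  have h₂ : IsIso (cohMap n (((tensorU u).mapHomologicalComplex _).map f)) := by
    have : IsIso ((HomotopyCategory.quotient _ _).map f) := by
      rw [hf]
      infer_instance
    exact inferInstanceAs (IsIso ((coh R n).map (((tensorU u).mapHomotopyCategory _).map
      ((HomotopyCategory.quotient _ _).map f))))
  rw [isIso_cohMap_iff] at h h₁ h₂ ⊢
  exact (quasiIsoAt_iff_of_comm ((unitC u).naturality f).symm n h₁ h₂).mp h

theorem quasiIsoAt_unitC_shift (X : CochainComplex (ModuleCat.{v} R) ℤ) (n m : ℤ) (hm : n + 1 = m)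
    (h : QuasiIsoAt ((unitC u).app X) m) : QuasiIsoAt ((unitC u).app (X⟦(1 : ℤ)⟧)) n := by
  have h' : (unitC u).app (X⟦(1 : ℤ)⟧) ≫ ((tensorU u).mapCochainComplexShiftIso 1).hom.app X =
      (((𝟭 _).mapCochainComplexShiftIso 1).hom.app X) ≫ ((unitC u).app X)⟦(1 : ℤ)⟧' := by
    ext n : 1
    exact (Category.comp_id _).trans (Category.id_comp _).symm
  refine (quasiIsoAt_iff_of_comm h' n inferInstance inferInstance).mpr ?_
  exact (quasiIsoAt_shift_iff ((unitC u).app X) 1 n m (by lia)).mpr h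

/-- `U ⊗_R^L W` agrees with `W` in degrees `≥ -2`. -/
structure IsLocal (W : ModuleCat.{v} R) : Prop where
  isIso_unitMap : IsIso ((unitMap u).app W)
  isZero_one : IsZero ((torU u 1).obj W)
  isZero_two : IsZero ((torU u 2).obj W)

variable {u}

theorem IsLocal.quasiIsoAt_unitC {W : ModuleCat.{v} R} (hW : IsLocal u W) (n : ℤ) (hn : -2 ≤ n) :
    QuasiIsoAt ((unitC u).app ((freeResolution R).obj W)) n := by
  by_cases h0 : n = 0
  · subst h0
    have h := (unitC u).naturality (freeAug.app W)
    have : IsIso ((unitC u).app ((CochainComplex.singleFunctor (ModuleCat.{v} R) 0).obj W)) := by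
      have (i : ℤ) : IsIso (((unitC u).app
          ((CochainComplex.singleFunctor (ModuleCat.{v} R) 0).obj W)).f i) := by
        change IsIso ((unitMap u).app
          (((CochainComplex.singleFunctor (ModuleCat.{v} R) 0).obj W).X i))
        by_cases hi : i = 0
        · subst hi
          exact (NatTrans.isIso_app_iff_of_iso (unitMap u)
            (HomologicalComplex.singleObjXSelf (.up ℤ) 0 W)).mpr hW.isIso_unitMap
        · have h0 := HomologicalComplex.isZero_single_obj_X (.up ℤ) 0 W i hi
          exact isIso_of_source_target_iso_zero _ h0.isoZero ((tensorU u).map_isZero h0).isoZero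
      exact HomologicalComplex.Hom.isIso_of_components _
    have h₁ : QuasiIsoAt (((𝟭 _).mapHomologicalComplex _).map (freeAug.app W)) 0 :=
      inferInstanceAs (QuasiIsoAt (freeAug.app W) 0)
    have h₂ : QuasiIsoAt (((tensorU u).mapHomologicalComplex _).map (freeAug.app W)) 0 :=
      quasiIsoAt_map_π' (tensorU u) (freeRes W)
    exact (quasiIsoAt_iff_of_comm h.symm 0 h₁ h₂).mpr inferInstance
  · have h₁ : IsZero (((freeResolution R).obj W).homology n) := by
      refine IsZero.of_iso ?_ (asIso (homologyMap (freeAug.app W) n))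
      exact (HomologicalComplex.exactAt_iff_isZero_homology _ _).1
        (HomologicalComplex.exactAt_single_obj _ _ _ _ h0)
    have h₂ : IsZero ((tensorRes u W).homology n) := by
      refine IsZero.of_iso ?_ ((HomotopyCategory.homologyFunctorFactors _ _ n).symm.app
        (tensorRes u W))
      obtain h | h | h : 0 < n ∨ n = -1 ∨ n = -2 := by lia
      · exact isZero_torH_of_pos u W n h
      · exact (isZero_torH_iff u W 0 n h).2 hW.isZero_one
      · exact (isZero_torH_iff u W 1 n h).2 hW.isZero_two
    rw [quasiIsoAt_iff_isIso_homologyMap]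
    exact isIso_of_source_target_iso_zero _ h₁.isoZero h₂.isoZero

/-- The cone of the map of resolutions is a resolution of the cokernel. -/
theorem quasiIsoAt_unitC_mappingCone {S : ShortComplex (ModuleCat.{v} R)} (hS : S.ShortExact)
    (hW : IsLocal u S.X₃) (n : ℤ) (hn : -2 ≤ n) :
    QuasiIsoAt ((unitC u).app (mappingCone ((freeResolution R).map S.f))) n := by
  obtain ⟨δ, hT⟩ := exists_resolve_distinguished hS
  have e := isoTriangleOfIso₁₂ _ _ hT
    (HomotopyCategory.mappingCone_triangleh_distinguished ((freeResolution R).map S.f))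
    (Iso.refl _) (Iso.refl _) ((Category.comp_id _).trans (Category.id_comp _).symm)
  exact quasiIsoAt_unitC_of_iso u (Triangle.π₃.mapIso e) n (hW.quasiIsoAt_unitC n hn)

/-- The cone of the map of resolutions is the shift of a resolution of the kernel. -/
theorem quasiIsoAt_unitC_mappingCone' {S : ShortComplex (ModuleCat.{v} R)} (hS : S.ShortExact)
    (hW : IsLocal u S.X₁) (n : ℤ) (hn : -3 ≤ n) :
    QuasiIsoAt ((unitC u).app (mappingCone ((freeResolution R).map S.g))) n := by
  obtain ⟨δ, hT⟩ := exists_resolve_distinguished hS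
  have e := isoTriangleOfIso₁₂ _ _ (rot_of_distTriang _ hT)
    (HomotopyCategory.mappingCone_triangleh_distinguished ((freeResolution R).map S.g))
    (Iso.refl _) (Iso.refl _) ((Category.comp_id _).trans (Category.id_comp _).symm)
  have e' : (HomotopyCategory.quotient _ _).obj (((freeResolution R).obj S.X₁)⟦(1 : ℤ)⟧) ≅
      (HomotopyCategory.quotient _ _).obj (mappingCone ((freeResolution R).map S.g)) :=
    ((HomotopyCategory.quotient _ _).commShiftIso (1 : ℤ)).app _ ≪≫ Triangle.π₃.mapIso e
  exact quasiIsoAt_unitC_of_iso u e' n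
    (quasiIsoAt_unitC_shift u _ n (n + 1) rfl (hW.quasiIsoAt_unitC (n + 1) (by lia)))

theorem isIso_torK_map {X Y : ModuleCat.{v} R} (f : X ⟶ Y)
    (hf : ∀ n, -2 ≤ n → QuasiIsoAt ((unitC u).app (mappingCone ((freeResolution R).map f))) n) :
    IsIso ((torK u 1).map f) := by
  have h := isIso_cohMap_tensorK u ((freeResolution R).map f) (-1) fun m hm _ =>
    (isIso_cohMap_iff m _).2 (hf m (by lia))
  rw [isIso_cohMap_iff, quasiIsoAt_iff_isIso_homologyMap] at h
  exact h

/-- `Tor_1(K, -)` inverts injections with local cokernel. -/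
theorem isIso_torK_map_f {S : ShortComplex (ModuleCat.{v} R)} (hS : S.ShortExact)
    (hW : IsLocal u S.X₃) : IsIso ((torK u 1).map S.f) :=
  isIso_torK_map _ fun n hn => quasiIsoAt_unitC_mappingCone hS hW n hn

/-- `Tor_1(K, -)` inverts surjections with local kernel. -/
theorem isIso_torK_map_g {S : ShortComplex (ModuleCat.{v} R)} (hS : S.ShortExact)
    (hW : IsLocal u S.X₁) : IsIso ((torK u 1).map S.g) :=
  isIso_torK_map _ fun n hn => quasiIsoAt_unitC_mappingCone' hS hW n (by lia)

end Local

/-! ### Vanishing of `Tor` for `U`-modules -/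

section TorVanishing

/-- The sum of copies of a module indexed by `I`. -/
abbrev copower (I : Type v) (X : ModuleCat.{v} R) : ModuleCat.{v} R := ModuleCat.of R (I →₀ X)

/-- The map induced on sums of copies. -/
abbrev copowerMap (I : Type v) {X Y : ModuleCat.{v} R} (f : X ⟶ Y) : copower I X ⟶ copower I Y :=
  ModuleCat.ofHom (Finsupp.mapRange.linearMap f.hom)

theorem shortExact_copower (I : Type v) {S : ShortComplex (ModuleCat.{v} R)} (hS : S.ShortExact) :
    (ShortComplex.mk (copowerMap I S.f) (copowerMap I S.g) (by
      ext1
      change Finsupp.mapRange.linearMap _ ∘ₗ Finsupp.mapRange.linearMap _ = 0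
      rw [← Finsupp.mapRange.linearMap_comp, ← ModuleCat.hom_comp, S.zero]
      ext; simp)).ShortExact := by
  have hf := hS.moduleCat_injective_f
  have hg := hS.moduleCat_surjective_g
  have hfg := (ShortComplex.ShortExact.moduleCat_exact_iff_function_exact _).1 hS.exact
  refine ModuleCat.shortComplex_shortExact _ (fun y => ⟨fun hy => ?_, ?_⟩) ?_ ?_
  · change Finsupp.mapRange _ (map_zero S.g.hom) y = 0 at hy
    choose l hl using fun i => (hfg (y i)).1 (DFunLike.congr_fun hy i)
    have hl0 (i) (hi : y i = 0) : l i = 0 := hf ((hl i).trans (hi.trans (map_zero S.f.hom).symm))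
    refine ⟨Finsupp.onFinset y.support l fun i hi => ?_, Finsupp.ext hl⟩
    rw [Finsupp.mem_support_iff]
    exact fun h => hi (hl0 i h)
  · rintro ⟨x, rfl⟩
    exact Finsupp.ext fun i => hfg.apply_apply_eq_zero (x i)
  · exact Finsupp.mapRange_injective _ (map_zero S.f.hom) hf
  · exact Finsupp.mapRange_surjective _ (map_zero S.g.hom) hg

/-- The tensor product commutes with direct sums, in the form: an element of `U ⊗_R X^(I)` is
determined by its components. -/
theorem eq_zero_of_copower (I : Type v) (X : ModuleCat.{v} R) (t : BaseChange u (I →₀ X))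
    (h : ∀ i, baseChangeMap u (Finsupp.lapply i : (I →₀ X) →ₗ[R] X) t = 0) : t = 0 := by
  classical
  have ht : ∃ s : Finset I, ∀ s' : Finset I, s ⊆ s' → t = ∑ i ∈ s',
      baseChangeMap u (Finsupp.lsingle i : X →ₗ[R] (I →₀ X))
        (baseChangeMap u (Finsupp.lapply i : (I →₀ X) →ₗ[R] X) t) := by
    clear h
    induction t using tmul_induction with
    | h v m =>
      refine ⟨m.support, fun s' hs' => ?_⟩
      simp only [baseChangeMap_tmul]
      have hm : ∑ i ∈ s', Finsupp.single i (m i) = m :=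
        (Finsupp.sum_of_support_subset m hs' Finsupp.single (by simp)).symm.trans m.sum_single
      have hv := map_sum (AddMonoidHom.mk' (tmul u v) (tmul_add u v))
        (fun i => Finsupp.single i (m i)) s'
      rw [hm] at hv
      exact hv
    | h_add x y hx hy =>
      obtain ⟨s, hs⟩ := hx
      obtain ⟨s', hs'⟩ := hy
      refine ⟨s ∪ s', fun s'' h => ?_⟩
      conv_lhs => rw [hs s'' (Finset.union_subset_left h), hs' s'' (Finset.union_subset_right h)]
      rw [← Finset.sum_add_distrib]
      simp only [map_add]
  obtain ⟨s, hs⟩ := ht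
  rw [hs s subset_rfl]
  exact Finset.sum_eq_zero fun i _ => by rw [h i, map_zero]

theorem mono_tensorU_copowerMap (I : Type v) {X Y : ModuleCat.{v} R} (f : X ⟶ Y)
    (hf : Mono ((tensorU u).map f)) : Mono ((tensorU u).map (copowerMap I f)) := by
  rw [ModuleCat.mono_iff_injective] at hf ⊢
  refine (injective_iff_map_eq_zero _).2 fun t ht => eq_zero_of_copower u I X t fun i => ?_
  apply hf
  have h := congrArg (fun g : copower I X ⟶ Y => (tensorU u).map g)
    (show ModuleCat.ofHom (Finsupp.lapply i) ≫ f =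
      copowerMap I f ≫ ModuleCat.ofHom (Finsupp.lapply i) from rfl)
  simp only [Functor.map_comp] at h
  refine (congrArg (fun g => g.hom t) h).trans ?_
  refine (congrArg ((tensorU u).map (ModuleCat.ofHom (Finsupp.lapply i))).hom ht).trans ?_
  exact (map_zero ((tensorU u).map
    (ModuleCat.ofHom (Finsupp.lapply i : (I →₀ Y) →ₗ[R] Y))).hom).trans
      (map_zero ((tensorU u).map f).hom).symm

theorem mono_torH_zero_iff {X Y : ModuleCat.{v} R} (f : X ⟶ Y) :
    Mono ((torH u 0).map f) ↔ Mono ((tensorU u).map f) :=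
  ((MorphismProperty.monomorphisms _).arrow_mk_iso_iff
    (((Functor.mapArrowFunctor _ _).mapIso (torHZero u)).app (Arrow.mk f)) :)

theorem isZero_torU_of_projective (n : ℕ) (hn : n ≠ 0) (P : Type v) [AddCommGroup P] [Module R P]
    [Module.Projective R P] : IsZero ((torU u n).obj (ModuleCat.of R P)) := by
  have : Projective (ModuleCat.of R P) :=
    (IsProjective.iff_projective.{v} (R := R) P).1 inferInstance
  obtain ⟨n, rfl⟩ := Nat.exists_eq_succ_of_ne_zero hn
  exact Functor.isZero_leftDerived_obj_projective_succ _ _ _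

variable (R) in
/-- The presentation of a module by the free module on its elements. -/
abbrev freeCover (X : ModuleCat.{v} R) : ShortComplex (ModuleCat.{v} R) :=
  (Finsupp.linearCombination R (id : X → X)).shortComplexKer

theorem shortExact_freeCover (X : ModuleCat.{v} R) : (freeCover R X).ShortExact :=
  LinearMap.shortExact_shortComplexKer (Finsupp.linearCombination_id_surjective R X)

section LongExact

variable {S : ShortComplex (ModuleCat.{v} R)} (hS : S.ShortExact)
include hS

theorem mono_tensorU_map (h : IsZero ((torU u 1).obj S.X₃)) : Mono ((tensorU u).map S.f) :=
  (mono_torH_zero_iff u S.f).1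
    (mono_torH_map u hS (-1) 0 (by lia) ((isZero_torH_iff u S.X₃ 0 (-1) rfl).2 h))

theorem isZero_torU_X₂ (n : ℕ) (h₁ : IsZero ((torU u (n + 1)).obj S.X₁))
    (h₃ : IsZero ((torU u (n + 1)).obj S.X₃)) : IsZero ((torU u (n + 1)).obj S.X₂) := by
  rw [← isZero_torH_iff u _ n _ rfl] at h₁ h₃ ⊢
  exact isZero_torH_X₂ u hS _ h₁ h₃

theorem isZero_torU_one_X₃ (h₂ : IsZero ((torU u 1).obj S.X₂))
    (h₁ : Mono ((tensorU u).map S.f)) : IsZero ((torU u 1).obj S.X₃) := by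
  rw [← isZero_torH_iff u _ 0 _ rfl] at h₂ ⊢
  exact isZero_torH_X₃ u hS _ 0 rfl h₂ ((mono_torH_zero_iff u S.f).2 h₁)

theorem isZero_torU_two_X₃ (h₂ : IsZero ((torU u 2).obj S.X₂))
    (h₁ : IsZero ((torU u 1).obj S.X₁)) : IsZero ((torU u 2).obj S.X₃) := by
  rw [← isZero_torH_iff u _ 1 _ rfl] at h₂ ⊢
  rw [← isZero_torH_iff u _ 0 _ rfl] at h₁
  exact isZero_torH_X₃ u hS _ _ (by lia) h₂ ⟨fun _ _ _ => h₁.eq_of_tgt _ _⟩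

theorem isZero_torU_one_X₁ (h₃ : IsZero ((torU u 2).obj S.X₃))
    (h₂ : IsZero ((torU u 1).obj S.X₂)) : IsZero ((torU u 1).obj S.X₁) := by
  rw [← isZero_torH_iff u _ 0 _ rfl] at h₂ ⊢
  rw [← isZero_torH_iff u _ 1 _ rfl] at h₃
  exact isZero_torH_X₁ u hS _ _ (by lia) h₃ ⟨fun _ _ _ => h₂.eq_of_tgt _ _⟩

end LongExact

/-- Compatibility of `Tor_1(U, -)` with direct sums is only needed for vanishing, where it follows
from that of `U ⊗_R -` with direct sums of injections. -/
theorem isZero_torU_one_copower (I : Type v) (X : ModuleCat.{v} R)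
    (h : IsZero ((torU u 1).obj X)) : IsZero ((torU u 1).obj (copower I X)) := by
  have hS := shortExact_copower I (shortExact_freeCover X)
  have h₁ := mono_tensorU_copowerMap u I _ (mono_tensorU_map u (shortExact_freeCover X) h)
  have h₂ := isZero_torU_of_projective u 1 one_ne_zero (I →₀ X →₀ R)
  have h₃ := isZero_torU_one_X₃ u hS h₂ h₁
  exact h₃

theorem isZero_torU_two_copower (I : Type v) (X : ModuleCat.{v} R)
    (h : IsZero ((torU u 2).obj X)) : IsZero ((torU u 2).obj (copower I X)) := by
  have hS := shortExact_copower I (shortExact_freeCover X)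
  have h₁ := isZero_torU_one_copower u I _ (isZero_torU_one_X₁ u (shortExact_freeCover X) h
    (isZero_torU_of_projective u 1 one_ne_zero (X →₀ R)))
  have h₂ := isZero_torU_of_projective u 2 two_ne_zero (I →₀ X →₀ R)
  have h₃ := isZero_torU_two_X₃ u hS h₂ h₁
  exact h₃

theorem shortExact_res {S : ShortComplex (ModuleCat.{v} U)} (hS : S.ShortExact) :
    (S.map (res u)).ShortExact :=
  ModuleCat.shortComplex_shortExact _
    ((ShortComplex.ShortExact.moduleCat_exact_iff_function_exact S).1 hS.exact)
    hS.moduleCat_injective_f hS.moduleCat_surjective_g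

/-- The presentation of a `U`-module by the free `U`-module on its elements, over `R`. -/
abbrev freeCoverU (V : ModuleCat.{v} U) : ShortComplex (ModuleCat.{v} R) :=
  (freeCover U V).map (res u)

theorem shortExact_freeCoverU (V : ModuleCat.{v} U) : (freeCoverU u V).ShortExact :=
  shortExact_res u (shortExact_freeCover V)

/-- Restriction of scalars commutes with direct sums of copies of `U`. -/
def resFinsuppIso (I : Type v) :
    (res u).obj (ModuleCat.of U (I →₀ U)) ≅ copower I (leftU u) :=
  LinearEquiv.toModuleIso (X₁ := (res u).obj (ModuleCat.of U (I →₀ U)))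
    (show (res u).obj (ModuleCat.of U (I →₀ U)) ≃ₗ[R] (I →₀ leftU u) from
    { AddEquiv.refl (I →₀ U) with map_smul' := fun _ _ => rfl })

variable {u} (hu : IsRingEpi u)
include hu

/-- Since `U ⊗_R V = V` for a `U`-module `V`, injections of `U`-modules stay injective. -/
theorem mono_tensorU_res_map {V W : ModuleCat.{v} U} (f : V ⟶ W) [Mono f] :
    Mono ((tensorU u).map ((res u).map f)) := by
  have h := (unitMap u).naturality ((res u).map f)
  have h₁ := isIso_unitMap hu V
  have h₂ := isIso_unitMap hu W
  refine ((MorphismProperty.monomorphisms _).arrow_mk_iso_iff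
    (Arrow.isoMk' ((res u).map f) ((tensorU u).map ((res u).map f))
      (@asIso _ _ _ _ _ h₁) (@asIso _ _ _ _ _ h₂) h.symm)).1 ?_
  exact (ModuleCat.mono_iff_injective _).2 ((ModuleCat.mono_iff_injective f).1 inferInstance)

theorem isZero_torU_one_res (h₁ : IsZero ((torU u 1).obj (leftU u))) (V : ModuleCat.{v} U) :
    IsZero ((torU u 1).obj ((res u).obj V)) := by
  have h := (isZero_torU_one_copower u V _ h₁).of_iso ((torU u 1).mapIso (resFinsuppIso u V))
  have : Mono (freeCover U V).f := (shortExact_freeCover V).mono_f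
  have h' := isZero_torU_one_X₃ u (shortExact_freeCoverU u V) h
    (mono_tensorU_res_map hu (freeCover U V).f)
  exact h'

/-- If `Tor_1(U, U)` and `Tor_2(U, U)` vanish then every `U`-module is local. -/
theorem isLocal_res (h₁ : IsZero ((torU u 1).obj (leftU u)))
    (h₂ : IsZero ((torU u 2).obj (leftU u))) (V : ModuleCat.{v} U) :
    IsLocal u ((res u).obj V) where
  isIso_unitMap := isIso_unitMap hu V
  isZero_one := isZero_torU_one_res hu h₁ V
  isZero_two := by
    have h := (isZero_torU_two_copower u V _ h₂).of_iso ((torU u 2).mapIso (resFinsuppIso u V))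
    have h' := isZero_torU_two_X₃ u (shortExact_freeCoverU u V) h (isZero_torU_one_res hu h₁ _)
    exact h'

end TorVanishing

/-! ### Vanishing of `Ext` from `U` to `U`-modules -/

section ExtVanishing

variable {S : ShortComplex (ModuleCat.{v} R)} (hS : S.ShortExact)

section
include hS

theorem shortExact_map_baseChange (h : IsZero ((torU u 1).obj S.X₃)) :
    (S.map (baseChange u)).ShortExact := by
  have hm := mono_tensorU_map u hS h
  rw [ModuleCat.mono_iff_injective] at hm
  have := hS.epi_g
  have he := (ShortComplex.exact_and_epi_g_iff_g_is_cokernel (S.map (baseChange u))).2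
    ⟨CokernelCofork.mapIsColimit _ hS.gIsCokernel (baseChange u)⟩
  exact { exact := he.1, mono_f := (ModuleCat.mono_iff_injective _).2 hm, epi_g := he.2 }

variable (h : IsZero ((torU u 1).obj S.X₃)) (hp : Projective ((baseChange u).obj S.X₃))
include h hp

theorem projective_baseChange_X₁ (hP : Projective S.X₂) :
    Projective ((baseChange u).obj S.X₁) := by
  have hp' : Projective (S.map (baseChange u)).X₃ := hp
  let s := (shortExact_map_baseChange u hS h).splittingOfProjective
  have := (baseChangeAdj u).map_projective S.X₂ hP
  exact Retract.projective (Y := (baseChange u).obj S.X₂)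
    { i := (baseChange u).map S.f
      r := s.r
      retract := s.f_r }

/-- If `U ⊗_R S` is a split short exact sequence, then maps to `U`-modules extend along the
injection of `S`. -/
theorem exists_extension {V : ModuleCat.{v} U} (f : S.X₁ ⟶ (res u).obj V) :
    ∃ g : S.X₂ ⟶ (res u).obj V, S.f ≫ g = f := by
  have hp' : Projective (S.map (baseChange u)).X₃ := hp
  let s := (shortExact_map_baseChange u hS h).splittingOfProjective
  obtain ⟨r, hs⟩ : ∃ r : (baseChange u).obj S.X₂ ⟶ (baseChange u).obj S.X₁,
    (baseChange u).map S.f ≫ r = 𝟙 _ := ⟨s.r, s.f_r⟩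
  let e := (baseChangeAdj u).homEquiv
  refine ⟨e _ _ (r ≫ (e _ _).symm f), ?_⟩
  rw [← Adjunction.homEquiv_naturality_left, reassoc_of% hs]
  exact (e _ _).apply_symm_apply f

end

variable {u}

/-- If `U ⊗_R X` is projective then a free cover of `X` splits after base change to `U`, so every
map from its kernel to a `U`-module extends to the free module. -/
theorem subsingleton_ext_one {X : ModuleCat.{v} R} (h : IsZero ((torU u 1).obj X))
    (hp : Projective ((baseChange u).obj X)) (V : ModuleCat.{v} U) :
    Subsingleton (Abelian.Ext.{v} X ((res u).obj V) 1) := by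
  have hS := shortExact_freeCover X
  refine subsingleton_of_forall_eq 0 fun x => ?_
  have : Projective (freeCover R X).X₂ :=
    (IsProjective.iff_projective.{v} (R := R) (X →₀ R)).1 inferInstance
  obtain ⟨y, rfl⟩ := Abelian.Ext.contravariant_sequence_exact₃ hS _ x
    (Abelian.Ext.eq_zero_of_projective _) (n₀ := 0) rfl
  obtain ⟨f, rfl⟩ := Abelian.Ext.mk₀_bijective _ _ |>.surjective y
  obtain ⟨g, rfl⟩ := exists_extension u hS h hp f
  rw [← Abelian.Ext.mk₀_comp_mk₀, hS.extClass_comp_assoc]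

theorem subsingleton_ext_two {X : ModuleCat.{v} R} (h : IsZero ((torU u 1).obj X))
    (h' : IsZero ((torU u 2).obj X))
    (hp : Projective ((baseChange u).obj X)) (V : ModuleCat.{v} U) :
    Subsingleton (Abelian.Ext.{v} X ((res u).obj V) 2) := by
  have hS := shortExact_freeCover X
  refine subsingleton_of_forall_eq 0 fun x => ?_
  have : Projective (freeCover R X).X₂ :=
    (IsProjective.iff_projective.{v} (R := R) (X →₀ R)).1 inferInstance
  obtain ⟨y, rfl⟩ := Abelian.Ext.contravariant_sequence_exact₃ hS _ x
    (Abelian.Ext.eq_zero_of_projective _) (n₀ := 1) rfl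
  have := subsingleton_ext_one (isZero_torU_one_X₁ u hS h'
    (isZero_torU_of_projective u 1 one_ne_zero (X →₀ R)))
    (projective_baseChange_X₁ u hS h hp this) V
  rw [Subsingleton.elim y 0, Abelian.Ext.comp_zero]

theorem projective_baseChange_leftU (hu : IsRingEpi u) :
    Projective ((baseChange u).obj (leftU u)) := by
  have e : (baseChange u).obj (leftU u) ≅ ModuleCat.of U U :=
    (LinearEquiv.ofBijective (mulMap u) hu).toModuleIso
  have : Projective (ModuleCat.of U U) :=
    (IsProjective.iff_projective.{v} (R := U) U).1 inferInstance
  exact Projective.of_iso e.symm this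

variable (hu : IsRingEpi u)
include hu

theorem subsingleton_ext_one_leftU (h₁ : IsZero ((torU u 1).obj (leftU u)))
    (V : ModuleCat.{v} U) :
    Subsingleton (Abelian.Ext.{v} (leftU u) ((res u).obj V) 1) :=
  subsingleton_ext_one h₁ (projective_baseChange_leftU hu) V

theorem subsingleton_ext_two_leftU (h₁ : IsZero ((torU u 1).obj (leftU u)))
    (h₂ : IsZero ((torU u 2).obj (leftU u))) (V : ModuleCat.{v} U) :
    Subsingleton (Abelian.Ext.{v} (leftU u) ((res u).obj V) 2) :=
  subsingleton_ext_two h₁ h₂ (projective_baseChange_leftU hu) V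

/-- A map from `U` to a `U`-module is determined by its value at `1`. -/
theorem subsingleton_hom_of_eq {V : ModuleCat.{v} U} {f : leftU u ⟶ (res u).obj V}
    (hf : uHom u ≫ f = 0) : f = 0 := by
  apply ModuleCat.hom_ext
  apply LinearMap.ext
  intro (w : U)
  have h := map_smul_of_isRingEpi hu (V := ModuleCat.of U U) f w (1 : U)
  have h1 : f.hom (1 : U) = 0 := by
    have := congrArg (fun g => g.hom (1 : R)) hf
    exact (congrArg f.hom (map_one u).symm).trans this
  have h2 : f.hom (show leftU u from w) = 0 := by
    refine (congrArg f.hom (show w = w * 1 from (mul_one w).symm)).trans (h.trans ?_)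
    have h3 : w • (0 : V) = 0 := smul_zero w
    exact (congrArg (fun x : V => w • x) h1).trans h3
  exact h2

end ExtVanishing

/-! ### The functor `Ext^1(K, -)` -/

section Triangulated

open Pretriangulated

variable {C : Type*} [Category* C] [Preadditive C] [HasZeroObject C] [HasShift C ℤ]
  [∀ n : ℤ, (shiftFunctor C n).Additive] [Pretriangulated C] {T : Triangle C}
  (hT : T ∈ distTriang C) {K : C}
include hT

/-- Maps from `K` see no difference between the first two terms of a distinguished triangle if there
are none to the third one in the adjacent degrees. -/
theorem bijective_comp_mor₁ (h₀ : ∀ f : K ⟶ T.obj₃, f = 0) (h₁ : ∀ f : K ⟶ T.obj₃⟦(1 : ℤ)⟧, f = 0) :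
    Function.Bijective fun f : K ⟶ T.obj₁⟦(1 : ℤ)⟧ => f ≫ T.mor₁⟦(1 : ℤ)⟧' := by
  constructor
  · intro f g (hfg : f ≫ _ = g ≫ _)
    rw [← sub_eq_zero] at hfg ⊢
    rw [← Preadditive.sub_comp] at hfg
    obtain ⟨x, hx⟩ := T.coyoneda_exact₁ hT _ hfg
    rw [hx, h₀ x, zero_comp]
  · intro f
    obtain ⟨x, hx⟩ := T.rotate.coyoneda_exact₁ (rot_of_distTriang _ hT) f (h₁ _)
    exact ⟨-x, (Preadditive.neg_comp _ _).trans ((Preadditive.comp_neg _ _).symm.trans hx.symm)⟩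

theorem bijective_comp_mor₂ (h₁ : ∀ f : K ⟶ T.obj₁⟦(1 : ℤ)⟧, f = 0)
    (h₂ : ∀ f : K ⟶ T.obj₁⟦(1 : ℤ)⟧⟦(1 : ℤ)⟧, f = 0) :
    Function.Bijective fun f : K ⟶ T.obj₂⟦(1 : ℤ)⟧ => f ≫ T.mor₂⟦(1 : ℤ)⟧' :=
  bijective_comp_mor₁ (rot_of_distTriang _ hT) h₁ h₂

end Triangulated

section HomK

open Pretriangulated

attribute [local instance] HasDerivedCategory.standard

variable (R) in
/-- The embedding of modules as complexes concentrated in degree `0` in the derived category. -/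
abbrev sg : ModuleCat.{v} R ⥤ DerivedCategory (ModuleCat.{v} R) :=
  DerivedCategory.singleFunctor (ModuleCat.{v} R) 0

/-- The triangle `R ⟶ U ⟶ K ⟶ R[1]` in the derived category. -/
abbrev triangleK : Triangle (DerivedCategory (ModuleCat.{v} R)) :=
  DerivedCategory.Q.mapTriangle.obj (CochainComplex.mappingCone.triangle
    ((CochainComplex.singleFunctor (ModuleCat.{v} R) 0).map (uHom u)))

theorem triangleK_distinguished : triangleK u ∈ distTriang (DerivedCategory (ModuleCat.{v} R)) :=
  DerivedCategory.mappingCone_triangle_distinguished _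

/-- The map `K ⟶ R[1]` in the derived category. -/
def deltaK : DerivedCategory.Q.obj (complexK u) ⟶ ((sg R).obj (ModuleCat.of R R))⟦(1 : ℤ)⟧ :=
  (triangleK u).mor₃

/-- A map from `K` factors through `K ⟶ R[1]` when maps `U ⟶ X` are determined by their restriction
to `R`. -/
theorem exists_deltaK_comp {X : DerivedCategory (ModuleCat.{v} R)}
    (h : ∀ f : (sg R).obj (leftU u) ⟶ X, (sg R).map (uHom u) ≫ f = 0 → f = 0)
    (f : DerivedCategory.Q.obj (complexK u) ⟶ X) :
    ∃ g, f = deltaK u ≫ g :=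
  Triangle.yoneda_exact₃ _ (triangleK_distinguished u) f
    (h _ (by
      have := comp_distTriang_mor_zero₁₂ _ (triangleK_distinguished u)
      exact (Category.assoc _ _ _).symm.trans
        ((congrArg (· ≫ f) this).trans zero_comp)))

theorem deltaK_comp_eq_zero_iff {X : DerivedCategory (ModuleCat.{v} R)}
    (g : ((sg R).obj (ModuleCat.of R R))⟦(1 : ℤ)⟧ ⟶ X) :
    deltaK u ≫ g = 0 ↔
      ∃ h : ((sg R).obj (leftU u))⟦(1 : ℤ)⟧ ⟶ X, g = ((sg R).map (uHom u))⟦(1 : ℤ)⟧' ≫ h := by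
  constructor
  · intro hg
    obtain ⟨h, hh⟩ :=
      Triangle.yoneda_exact₃ _ (rot_of_distTriang _ (triangleK_distinguished u)) g hg
    exact ⟨-h, hh.trans ((Preadditive.neg_comp _ _).trans (Preadditive.comp_neg _ _).symm)⟩
  · rintro ⟨h, rfl⟩
    have := comp_distTriang_mor_zero₃₁ _ (triangleK_distinguished u)
    exact (Category.assoc _ _ _).symm.trans ((congrArg (· ≫ h) this).trans zero_comp)

theorem exists_sg_map_shift {X Y : ModuleCat.{v} R}
    (f : ((sg R).obj X)⟦(1 : ℤ)⟧ ⟶ ((sg R).obj Y)⟦(1 : ℤ)⟧) :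
    ∃ g : X ⟶ Y, ((sg R).map g)⟦(1 : ℤ)⟧' = f := by
  obtain ⟨g, rfl⟩ := (shiftFunctor (DerivedCategory (ModuleCat.{v} R)) (1 : ℤ)).map_surjective f
  obtain ⟨g, rfl⟩ := (sg R).map_surjective g
  exact ⟨g, rfl⟩

theorem hom_shift_zero_eq_zero {X Y : ModuleCat.{v} R}
    (f : ((sg R).obj X)⟦(1 : ℤ)⟧ ⟶ (sg R).obj Y) :
    f = 0 := by
  have : (((CochainComplex.singleFunctor _ 0).obj X)⟦(1 : ℤ)⟧).IsStrictlyLE (-1) :=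
    CochainComplex.isStrictlyLE_shift _ 0 _ _ (by lia)
  have : ((CochainComplex.singleFunctor _ 0).obj Y).IsStrictlyGE 0 := inferInstance
  have h := (DerivedCategory.subsingleton_hom_of_isStrictlyLE_of_isStrictlyGE
    (((CochainComplex.singleFunctor _ 0).obj X)⟦(1 : ℤ)⟧) ((CochainComplex.singleFunctor _ 0).obj Y)
    (-1) 0 (by lia))
  refine (cancel_epi ((DerivedCategory.Q.commShiftIso (1 : ℤ)).hom.app
    ((CochainComplex.singleFunctor _ 0).obj X))).1 ?_
  exact h.elim _ _

theorem hom_shift_one_eq_zero {X Y : ModuleCat.{v} R} (h : Subsingleton (Abelian.Ext.{v} X Y 1))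
    (f : (sg R).obj X ⟶ ((sg R).obj Y)⟦(1 : ℤ)⟧) : f = 0 :=
  (Abelian.Ext.homEquiv (n := 1)).symm.subsingleton.elim f 0

theorem hom_shift_two_eq_zero {X Y : ModuleCat.{v} R} (h : Subsingleton (Abelian.Ext.{v} X Y 2))
    (f : (sg R).obj X ⟶ ((sg R).obj Y)⟦(1 : ℤ)⟧⟦(1 : ℤ)⟧) : f = 0 := by
  rw [← cancel_mono
    ((shiftFunctorAdd' (DerivedCategory (ModuleCat.{v} R)) (1 : ℤ) 1 2 rfl).inv.app _)]
  exact (Abelian.Ext.homEquiv (n := 2)).symm.subsingleton.elim _ _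

section

variable {u} (hu : IsRingEpi u)
include hu

/-- `Hom(K, V) = 0` for a `U`-module `V`: maps `U ⟶ V` are determined by their restriction to `R`,
and there are no maps `R[1] ⟶ V`. -/
theorem homK_zero_eq_zero (V : ModuleCat.{v} U)
    (f : DerivedCategory.Q.obj (complexK u) ⟶ (sg R).obj ((res u).obj V)) : f = 0 := by
  obtain ⟨g, rfl⟩ := exists_deltaK_comp u (fun f hf => by
    obtain ⟨f, rfl⟩ := (sg R).map_surjective f
    rw [← Functor.map_comp, ← (sg R).map_zero] at hf
    rw [subsingleton_hom_of_eq hu ((sg R).map_injective hf), Functor.map_zero]) f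
  rw [hom_shift_zero_eq_zero g, comp_zero]

/-- `Hom(K, V[1]) = 0` for a `U`-module `V`: as `Ext^1(U, V) = 0`, such a map comes from a map
`R ⟶ V`, which extends to `U`. -/
theorem homK_one_eq_zero (h₁ : IsZero ((torU u 1).obj (leftU u))) (V : ModuleCat.{v} U)
    (f : DerivedCategory.Q.obj (complexK u) ⟶ ((sg R).obj ((res u).obj V))⟦(1 : ℤ)⟧) : f = 0 := by
  obtain ⟨g, rfl⟩ := exists_deltaK_comp u
    (fun f _ => hom_shift_one_eq_zero (subsingleton_ext_one_leftU hu h₁ V) f) f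
  obtain ⟨g, rfl⟩ := exists_sg_map_shift g
  rw [deltaK_comp_eq_zero_iff]
  refine ⟨((sg R).map ((res u).map
    (ModuleCat.ofHom (LinearMap.toSpanSingleton U V (g.hom (1 : R))))))⟦(1 : ℤ)⟧', ?_⟩
  rw [← Functor.map_comp, ← Functor.map_comp]
  congr 2
  apply ModuleCat.hom_ext
  apply LinearMap.ext_ring
  have h : (u 1) • (show V from g.hom (1 : R)) = (show V from g.hom (1 : R)) := by
    rw [map_one, one_smul]
  exact h.symm

/-- `Hom(K, V[2]) = 0` for a `U`-module `V`, as `Ext^2(U, V) = 0 = Ext^1(R, V)`. -/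
theorem homK_two_eq_zero (h₁ : IsZero ((torU u 1).obj (leftU u)))
    (h₂ : IsZero ((torU u 2).obj (leftU u))) (V : ModuleCat.{v} U)
    (f : DerivedCategory.Q.obj (complexK u) ⟶
      ((sg R).obj ((res u).obj V))⟦(1 : ℤ)⟧⟦(1 : ℤ)⟧) : f = 0 := by
  obtain ⟨g, rfl⟩ := exists_deltaK_comp u
    (fun f _ => hom_shift_two_eq_zero (subsingleton_ext_two_leftU hu h₁ h₂ V) f) f
  obtain ⟨g, rfl⟩ := (shiftFunctor (DerivedCategory (ModuleCat.{v} R)) (1 : ℤ)).map_surjective g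
  have : Projective (ModuleCat.of R R) :=
    (IsProjective.iff_projective.{v} (R := R) R).1 inferInstance
  rw [hom_shift_one_eq_zero (Abelian.Ext.subsingleton_of_projective _ _ 0) g, Functor.map_zero,
    comp_zero]

end

theorem isIso_extK_map {X Y : ModuleCat.{v} R} (f : X ⟶ Y)
    (hf : Function.Bijective fun g : DerivedCategory.Q.obj (complexK u) ⟶ ((sg R).obj X)⟦(1 : ℤ)⟧ =>
      g ≫ ((sg R).map f)⟦(1 : ℤ)⟧') : IsIso ((extK u 1).map f) := by
  rw [ConcreteCategory.isIso_iff_bijective]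
  exact (Shrink.linearEquiv R _).symm.bijective.comp
    (hf.comp (Shrink.linearEquiv R (HomKShift u 1 X)).bijective)

section

variable {u} (hu : IsRingEpi u) (h₁ : IsZero ((torU u 1).obj (leftU u)))
include hu h₁

/-- `Ext^1(K, -)` inverts injections whose cokernel is a `U`-module. -/
theorem isIso_extK_map_f {S : ShortComplex (ModuleCat.{v} R)} (hS : S.ShortExact)
    {V : ModuleCat.{v} U} (e : S.X₃ ≅ (res u).obj V) : IsIso ((extK u 1).map S.f) := by
  refine isIso_extK_map u _ (bijective_comp_mor₁ hS.singleTriangle_distinguished ?_ ?_)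
  · intro f
    refine (cancel_mono ((sg R).map e.hom)).1 ?_
    exact (homK_zero_eq_zero hu V _).trans zero_comp.symm
  · intro f
    refine (cancel_mono (((sg R).map e.hom)⟦(1 : ℤ)⟧')).1 ?_
    exact (homK_one_eq_zero hu h₁ V _).trans zero_comp.symm

/-- `Ext^1(K, -)` inverts surjections whose kernel is a `U`-module. -/
theorem isIso_extK_map_g (h₂ : IsZero ((torU u 2).obj (leftU u)))
    {S : ShortComplex (ModuleCat.{v} R)} (hS : S.ShortExact)
    {V : ModuleCat.{v} U} (e : S.X₁ ≅ (res u).obj V) : IsIso ((extK u 1).map S.g) := by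
  refine isIso_extK_map u _ (bijective_comp_mor₂ hS.singleTriangle_distinguished ?_ ?_)
  · intro f
    refine (cancel_mono (((sg R).map e.hom)⟦(1 : ℤ)⟧')).1 ?_
    exact (homK_one_eq_zero hu h₁ V _).trans zero_comp.symm
  · intro f
    refine (cancel_mono (((sg R).map e.hom)⟦(1 : ℤ)⟧'⟦(1 : ℤ)⟧')).1 ?_
    exact (homK_two_eq_zero hu h₁ h₂ V _).trans zero_comp.symm

end

/-- The map `R ⟶ X` with value `x` at `1`. -/
def pointHom {X : ModuleCat.{v} R} (x : X) : ModuleCat.of R R ⟶ X :=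
  ModuleCat.ofHom (LinearMap.toSpanSingleton R X x)

/-- The map `K ⟶ R[1]` is compatible with the right actions of `R`. -/
theorem rightMulK_comp_deltaK (r : R) :
    DerivedCategory.Q.map (rightMulK u r) ≫ deltaK u =
      deltaK u ≫ ((sg R).map (rightMulR r))⟦(1 : ℤ)⟧' :=
  ((DerivedCategory.Q.mapTriangle.map (CochainComplex.mappingCone.triangleMap _ _
    ((CochainComplex.singleFunctor (ModuleCat.{v} R) 0).map (rightMulR r))
    ((CochainComplex.singleFunctor (ModuleCat.{v} R) 0).map (rightMulU u r))
    (by rw [← Functor.map_comp, ← Functor.map_comp, uHom_rightMul]))).comm₃).symm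

/-- The map `X → Hom(K, X[1])` induced by `K ⟶ R[1]`. -/
def toHomK (X : ModuleCat.{v} R) : X →ₗ[R] HomKShift u 1 X where
  toFun x := deltaK u ≫ ((sg R).map (pointHom x))⟦(1 : ℤ)⟧'
  map_add' x y := by
    have h : pointHom (x + y) = pointHom x + pointHom y := by
      ext
      simp [pointHom]
    rw [h, Functor.map_add, Functor.map_add]
    exact Preadditive.comp_add _ _ _ _ _ _
  map_smul' r x := by
    have h : pointHom (r • x) = rightMulR r ≫ pointHom x := by
      ext
      simp [pointHom, rightMulR]
    rw [h, Functor.map_comp, Functor.map_comp]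
    change _ = DerivedCategory.Q.map (rightMulK u r) ≫ deltaK u ≫ _
    rw [← Category.assoc, ← Category.assoc, rightMulK_comp_deltaK]

/-- The natural map `X → Ext^1(K, X)`. -/
def toExtK : 𝟭 (ModuleCat.{v} R) ⟶ extK u 1 where
  app X := ModuleCat.ofHom (Y := (extK u 1).obj X)
    ((Shrink.linearEquiv R (HomKShift u 1 X)).symm.toLinearMap ∘ₗ toHomK u X)
  naturality X Y f := by
    apply ModuleCat.hom_ext
    apply LinearMap.ext
    intro x
    change (Shrink.linearEquiv R (HomKShift u 1 Y)).symm (toHomK u Y (f.hom x)) =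
      (Shrink.linearEquiv R (HomKShift u 1 Y)).symm (HomKShift.map u 1 f
        (Shrink.linearEquiv R (HomKShift u 1 X) ((Shrink.linearEquiv R (HomKShift u 1 X)).symm
          (toHomK u X x))))
    rw [LinearEquiv.apply_symm_apply]
    congr 1
    change deltaK u ≫ _ = (deltaK u ≫ _) ≫ _
    have h : pointHom (f.hom x) = pointHom x ≫ f := by
      ext
      simp [pointHom]
    rw [h, Functor.map_comp, Functor.map_comp, Category.assoc]

/-- The map `C → Ext^1(K, C)` is an isomorphism for a `u`-contramodule `C`. -/
theorem isIso_toExtK_app {C : ModuleCat.{v} R} (hC : IsContramodule u C) :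
    IsIso ((toExtK u).app C) := by
  rw [ConcreteCategory.isIso_iff_bijective]
  refine (Shrink.linearEquiv R (HomKShift u 1 C)).symm.bijective.comp ⟨?_, fun f => ?_⟩
  · refine (injective_iff_map_eq_zero _).2 fun x hx => ?_
    obtain ⟨h, hh⟩ := (deltaK_comp_eq_zero_iff u _).1 hx
    obtain ⟨h, rfl⟩ := exists_sg_map_shift h
    rw [hC.1.elim h 0, Functor.map_zero, Functor.map_zero, comp_zero] at hh
    have h0 : pointHom x = 0 := by
      apply (sg R).map_injective
      apply (shiftFunctor _ (1 : ℤ)).map_injective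
      rw [hh, Functor.map_zero, Functor.map_zero]
    simpa [pointHom] using congrArg (fun g => g.hom (1 : R)) h0
  · obtain ⟨g, hg⟩ := exists_deltaK_comp u (fun f _ => hom_shift_one_eq_zero hC.2 f) f
    obtain ⟨g, rfl⟩ := exists_sg_map_shift g
    refine ⟨g.hom (1 : R), ?_⟩
    have h : pointHom (g.hom (1 : R)) = g := by
      ext
      simp [pointHom]
    change deltaK u ≫ _ = f
    rw [h, hg]

instance : (extK u 1).Additive where
  map_add {X Y f g} := by
    have h : HomKShift.map u 1 (f + g) = HomKShift.map u 1 f + HomKShift.map u 1 g := by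
      apply LinearMap.ext
      intro x
      change x ≫ ((sg R).map (f + g))⟦(1 : ℤ)⟧' = _
      rw [Functor.map_add, Functor.map_add]
      exact Preadditive.comp_add _ _ _ _ _ _
    apply ModuleCat.hom_ext
    change (Shrink.linearEquiv R _).symm.toLinearMap ∘ₗ HomKShift.map u 1 (f + g) ∘ₗ _ = _
    rw [h, LinearMap.add_comp, LinearMap.comp_add]
    rfl

end HomK

/-! ### The functor `Tor_1(K, -)` -/

section TorK

open CochainComplex Pretriangulated HomologicalComplex

theorem isIso_map_of_isIso_map_comp {C D : Type*} [Category* C] [Category* D] (F : C ⥤ D)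
    {X Y Z : C} (f : X ⟶ Y) (e : Y ≅ Z) (h : IsIso (F.map (f ≫ e.hom))) :
    IsIso (F.map f) := by
  rw [Functor.map_comp] at h
  exact IsIso.of_isIso_comp_right (F.map f) (F.map e.hom)

/-- The natural map `K ⊗_R P ⟶ P[1]`. -/
def tensorKDelta : tensorK u ⟶
    (𝟭 (ModuleCat.{v} R)).mapHomologicalComplex _ ⋙ CategoryTheory.shiftFunctor _ (1 : ℤ) where
  app P := (mappingCone.triangle ((unitC u).app P)).mor₃
  naturality P Q f := (mappingCone.triangleMap ((unitC u).app P) ((unitC u).app Q) _ _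
    (NatTrans.naturality (unitC u) f).symm).comm₃.symm

variable (R) in
/-- The zeroth cohomology of the canonical free resolution. -/
def homologyFreeResolution :
    freeResolution R ⋙ (𝟭 (ModuleCat.{v} R)).mapHomologicalComplex _ ⋙
      CategoryTheory.shiftFunctor _ (1 : ℤ) ⋙ HomologicalComplex.homologyFunctor _ _ (-1) ≅
      𝟭 (ModuleCat.{v} R) :=
  have (X : ModuleCat.{v} R) : IsIso ((Functor.whiskerRight (freeAug (R := R))
      (HomologicalComplex.homologyFunctor _ _ 0)).app X) :=
    inferInstanceAs (IsIso (homologyMap (freeAug.app X) 0))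
  have := NatIso.isIso_of_isIso_app (Functor.whiskerRight (freeAug (R := R))
      (HomologicalComplex.homologyFunctor _ _ 0))
  Functor.isoWhiskerLeft (freeResolution R)
    (Functor.isoWhiskerRight (Functor.mapHomologicalComplexIdIso _ _)
      (CategoryTheory.shiftFunctor _ (1 : ℤ) ⋙ HomologicalComplex.homologyFunctor _ _ (-1))) ≪≫
  Functor.isoWhiskerLeft (freeResolution R)
    ((HomologicalComplex.homologyFunctor (ModuleCat.{v} R) (ComplexShape.up ℤ) 0).shiftIso
      (1 : ℤ) (-1) 0 (by lia)) ≪≫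
  @asIso _ _ _ _ _ this ≪≫
  HomologicalComplex.homologyFunctorSingleIso (ModuleCat.{v} R) (ComplexShape.up ℤ) 0

/-- The natural map `Tor_1(K, X) → X`. -/
def fromTorK : torK u 1 ⟶ 𝟭 (ModuleCat.{v} R) :=
  Functor.whiskerLeft (freeResolution R) (Functor.whiskerRight (tensorKDelta u)
    (HomologicalComplex.homologyFunctor _ _ (-1))) ≫ (homologyFreeResolution R).hom

/-- The map `Tor_1(K, M) → M` is an isomorphism for a `u`-comodule `M`: its kernel and cokernel come
from `Tor_1(U, M)` and `U ⊗_R M`. -/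
theorem isIso_fromTorK_app {M : ModuleCat.{v} R} (hM : IsComodule u M) :
    IsIso ((fromTorK u).app M) := by
  let P := (freeResolution R).obj M
  have h : IsIso (cohMap (-1) ((tensorKDelta u).app P)) := by
    have hT := rot_of_distTriang _
      (HomotopyCategory.mappingCone_triangleh_distinguished ((unitC u).app P))
    obtain ⟨δ, ⟨w₁, e₁⟩, ⟨w₂, e₂⟩, -⟩ := coh_exact _ hT (-1)
    have h₁ : IsZero ((torH u (-1)).obj M) := (isZero_torH_iff u M 0 (-1) rfl).2 hM.2
    have h₀ : IsZero ((torH u 0).obj M) := hM.1.of_iso ((torHZero u).app M)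
    have hm := e₁.mono_g (h₁.eq_of_src _ _)
    have he := e₂.epi_f (h₀.eq_of_tgt _ _)
    have h' := isIso_of_mono_of_epi
      ((coh R (-1)).map ((mappingCone.triangleh ((unitC u).app P)).rotate.mor₂))
    exact isIso_map_of_isIso_map_comp (coh R (-1)) _
      (((HomotopyCategory.quotient (ModuleCat.{v} R) (ComplexShape.up ℤ)).commShiftIso
        (1 : ℤ)).app _) h'
  rw [isIso_cohMap_iff, quasiIsoAt_iff_isIso_homologyMap] at h
  exact @IsIso.comp_isIso _ _ _ _ _ _ _ h inferInstance

end TorK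

/-! ### From comodules to contramodules -/

section Coextension

/-- Both `Ext^1(K, -)` and `Tor_1(K, -)` invert `f`. -/
structure IsInverted {X Y : ModuleCat.{v} R} (f : X ⟶ Y) : Prop where
  isIso_extK : IsIso ((extK u 1).map f)
  isIso_torK : IsIso ((torK u 1).map f)

/-- The `U`-module `Hom_R(U, X)`, as an `R`-module. -/
abbrev homU (X : ModuleCat.{v} R) : ModuleCat.{v} R :=
  (res u).obj ((ModuleCat.coextendScalars u).obj X)

/-- The evaluation `Hom_R(U, X) → X` at `1`. -/
abbrev evalOne (X : ModuleCat.{v} R) : homU u X ⟶ X :=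
  (ModuleCat.restrictCoextendScalarsAdj u).counit.app X

/-- The map `Hom_R(U, X) → Hom_R(U, Y)` induced by `X → Y`. -/
abbrev homUMap {X Y : ModuleCat.{v} R} (f : X ⟶ Y) : homU u X ⟶ homU u Y :=
  (res u).map ((ModuleCat.coextendScalars u).map f)

theorem homUMap_evalOne {X Y : ModuleCat.{v} R} (f : X ⟶ Y) :
    homUMap u f ≫ evalOne u Y = evalOne u X ≫ f :=
  (ModuleCat.restrictCoextendScalarsAdj u).counit.naturality f

theorem exists_lift_evalOne {X : ModuleCat.{v} R} (f : leftU u ⟶ X) :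
    ∃ g : leftU u ⟶ homU u X, g ≫ evalOne u X = f := by
  refine ⟨(res u).map ((ModuleCat.restrictCoextendScalarsAdj u).homEquiv _ _ f), ?_⟩
  rw [← Adjunction.homEquiv_counit, Equiv.symm_apply_apply]

/-- An element of `Hom_R(U, X)`, as a morphism. -/
def homUHom {X : ModuleCat.{v} R} (x : homU u X) : leftU u ⟶ X :=
  ModuleCat.ofHom (X := leftU u) (ModuleCat.CoextendScalars.equiv u X x)

variable {u}

theorem eq_zero_of_homUHom {X : ModuleCat.{v} R} (x : homU u X) (h : homUHom u x = 0) : x = 0 := by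
  apply (ModuleCat.CoextendScalars.equiv u X).injective
  exact congrArg ModuleCat.Hom.hom h

theorem IsLocal.of_iso {W W' : ModuleCat.{v} R} (hW : IsLocal u W) (e : W ≅ W') : IsLocal u W' where
  isIso_unitMap := (NatTrans.isIso_app_iff_of_iso (unitMap u) e).1 hW.isIso_unitMap
  isZero_one := hW.isZero_one.of_iso ((torU u 1).mapIso e.symm)
  isZero_two := hW.isZero_two.of_iso ((torU u 2).mapIso e.symm)

theorem isInverted_of_shortExact_f (hu : IsRingEpi u) (h₁ : IsZero ((torU u 1).obj (leftU u)))
    (h₂ : IsZero ((torU u 2).obj (leftU u))) {S : ShortComplex (ModuleCat.{v} R)}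
    (hS : S.ShortExact) {V : ModuleCat.{v} U} (e : S.X₃ ≅ (res u).obj V) :
    IsInverted u S.f where
  isIso_extK := isIso_extK_map_f hu h₁ hS e
  isIso_torK := isIso_torK_map_f hS ((isLocal_res hu h₁ h₂ V).of_iso e.symm)

theorem isInverted_of_shortExact_g (hu : IsRingEpi u) (h₁ : IsZero ((torU u 1).obj (leftU u)))
    (h₂ : IsZero ((torU u 2).obj (leftU u))) {S : ShortComplex (ModuleCat.{v} R)}
    (hS : S.ShortExact) {V : ModuleCat.{v} U} (e : S.X₁ ≅ (res u).obj V) :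
    IsInverted u S.g where
  isIso_extK := isIso_extK_map_g hu h₁ h₂ hS e
  isIso_torK := isIso_torK_map_g hS ((isLocal_res hu h₁ h₂ V).of_iso e.symm)

section RingEpi

variable (hu : IsRingEpi u)
include hu

/-- A map `U → Hom(U, X)` is determined by its composite with the evaluation at `1`, being
`U`-linear. -/
theorem hom_ext_evalOne {X : ModuleCat.{v} R} {f g : leftU u ⟶ homU u X}
    (h : f ≫ evalOne u X = g ≫ evalOne u X) : f = g := by
  rw [← sub_eq_zero] at h ⊢
  rw [← Preadditive.sub_comp] at h
  generalize f - g = k at h ⊢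
  have hk (w : U) :
      k.hom w = (w • (show (ModuleCat.coextendScalars u).obj X from k.hom (1 : U))) := by
    have h := map_smul_of_isRingEpi hu (V := ModuleCat.of U U) k w (1 : U)
    exact (congrArg k.hom (show w = w * 1 from (mul_one w).symm)).trans h
  have h1 : k.hom (1 : U) = 0 := by
    apply eq_zero_of_homUHom
    apply ModuleCat.hom_ext
    apply LinearMap.ext
    intro (w : U)
    have h0 := congrArg (fun f => f.hom w) h
    change (homUHom u (k.hom w)).hom (1 : U) = 0 at h0
    rw [hk] at h0
    have h2 := ModuleCat.CoextendScalars.smul_apply u X (k.hom (1 : U)) w 1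
    rw [one_mul] at h2
    exact h2.symm.trans h0
  apply ModuleCat.hom_ext
  apply LinearMap.ext
  intro (w : U)
  refine (hk w).trans ?_
  rw [h1]
  have h3 : w • (0 : (ModuleCat.coextendScalars u).obj X) = 0 := smul_zero w
  exact h3

end RingEpi

section Pullback

variable (u) (S : ShortComplex (ModuleCat.{v} R))

/-- The map `I × Hom(U, Z) → Z`, `(x, f) ↦ p(x) - f(1)`, for a surjection `p : I → Z`. -/
abbrev subEval : (S.X₂ × homU u S.X₃) →ₗ[R] S.X₃ :=
  S.g.hom ∘ₗ LinearMap.fst R S.X₂ (homU u S.X₃) -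
    (evalOne u S.X₃).hom ∘ₗ LinearMap.snd R S.X₂ (homU u S.X₃)

/-- The fibre product of `I` and `Hom(U, Z)` over `Z`. -/
abbrev pullbackHomU : ModuleCat.{v} R := ModuleCat.of R (LinearMap.ker (subEval u S))

/-- The projection to `I`. -/
abbrev pullbackFst : pullbackHomU u S ⟶ S.X₂ :=
  ModuleCat.ofHom (LinearMap.fst R S.X₂ (homU u S.X₃) ∘ₗ Submodule.subtype _)

/-- The projection to `Hom(U, Z)`. -/
abbrev pullbackSnd : pullbackHomU u S ⟶ homU u S.X₃ :=
  ModuleCat.ofHom (Y := homU u S.X₃) (LinearMap.snd R S.X₂ (homU u S.X₃) ∘ₗ Submodule.subtype _)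

variable {u S} in
theorem pullbackHomU_hom_ext {X : ModuleCat.{v} R} {f g : X ⟶ pullbackHomU u S}
    (h₁ : f ≫ pullbackFst u S = g ≫ pullbackFst u S)
    (h₂ : f ≫ pullbackSnd u S = g ≫ pullbackSnd u S) : f = g := by
  apply ModuleCat.hom_ext
  apply LinearMap.ext
  intro x
  exact Subtype.ext (Prod.ext (congrArg (fun f => f.hom x) h₁) (congrArg (fun f => f.hom x) h₂))

theorem pullback_condition :
    pullbackFst u S ≫ S.g = pullbackSnd u S ≫ evalOne u S.X₃ := by
  apply ModuleCat.hom_ext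
  apply LinearMap.ext
  intro x
  exact sub_eq_zero.1 x.2

/-- The map into the fibre product given by its two components. -/
abbrev pullbackLift {X : ModuleCat.{v} R} (f : X ⟶ S.X₂) (g : X ⟶ homU u S.X₃)
    (w : f ≫ S.g = g ≫ evalOne u S.X₃) : X ⟶ pullbackHomU u S :=
  ModuleCat.ofHom (LinearMap.codRestrict _ (LinearMap.prod f.hom g.hom) fun x =>
    sub_eq_zero.2 (congrArg (fun f => f.hom x) w))

/-- The map `M → T` from the kernel of `I → Z` to the fibre product. -/
abbrev kernelToPullback : S.X₁ ⟶ pullbackHomU u S :=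
  pullbackLift u S S.f 0 (by rw [S.zero, zero_comp])

/-- The map `Hom(U, I) → T`. -/
abbrev homUToPullback : homU u S.X₂ ⟶ pullbackHomU u S :=
  pullbackLift u S (evalOne u S.X₂) (homUMap u S.g) (homUMap_evalOne u S.g).symm

variable {S} (hS : S.ShortExact)
include hS

theorem shortExact_kernelToPullback :
    (ShortComplex.mk (kernelToPullback u S) (pullbackSnd u S) rfl).ShortExact := by
  refine ModuleCat.shortComplex_shortExact _ (fun y => ⟨fun hy => ?_, ?_⟩) (fun x y h => ?_)
    (fun y => ?_)
  · obtain ⟨⟨x, f⟩, hx⟩ := y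
    obtain rfl : f = 0 := hy
    have hx' : S.g x = 0 := (sub_eq_zero.1 hx).trans (map_zero (evalOne u S.X₃).hom)
    obtain ⟨m, hm⟩ :=
      ((ShortComplex.ShortExact.moduleCat_exact_iff_function_exact S).1 hS.exact x).1 hx'
    exact ⟨m, Subtype.ext (Prod.ext hm rfl)⟩
  · rintro ⟨x, rfl⟩
    rfl
  · exact hS.moduleCat_injective_f (congrArg (fun y => y.1.1) h)
  · obtain ⟨x, hx⟩ := hS.moduleCat_surjective_g ((evalOne u S.X₃).hom y)
    exact ⟨⟨(x, y), sub_eq_zero.2 hx⟩, rfl⟩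

/-- Cospeciality of `M`, the kernel of `I → Z`, makes `Hom(U, I) → T` injective: an element of the
kernel is a map `U → M` vanishing at `1`. -/
theorem shortExact_homUToPullback (hM : IsCospecial u S.X₁) :
    (ShortComplex.mk (homUToPullback u S) (ModuleCat.ofHom (LinearMap.range
      (homUToPullback u S).hom).mkQ) (by
        ext1
        exact LinearMap.range_mkQ_comp _)).ShortExact := by
  refine ModuleCat.shortComplex_shortExact _ (fun y => Submodule.Quotient.mk_eq_zero _) ?_
    (Submodule.mkQ_surjective _)
  refine (injective_iff_map_eq_zero (homUToPullback u S).hom).2 fun x hx => ?_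
  have h₁ : (evalOne u S.X₂).hom x = 0 := congrArg (fun y => y.1.1) hx
  have h₂ : (homUMap u S.g).hom x = 0 := congrArg (fun y => y.1.2) hx
  have h₃ : homUHom u x ≫ S.g = 0 := congrArg (homUHom u) h₂
  have := hS.mono_f
  apply eq_zero_of_homUHom
  rw [← hS.exact.lift_f _ h₃]
  have h₄ : hS.exact.lift _ h₃ = 0 := by
    apply hM
    apply hS.moduleCat_injective_f
    refine (congrArg (fun f => f.hom (1 : U)) (hS.exact.lift_f _ h₃)).trans ?_
    exact h₁.trans (map_zero S.f.hom).symm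
  rw [h₄, zero_comp]

end Pullback

end Coextension

section Pullback

open Abelian

variable {u} {S : ShortComplex (ModuleCat.{v} R)}

/-- The quotient `C` of the fibre product by `Hom(U, I)`. -/
abbrev pullbackQuotient (u : R →+* U) (S : ShortComplex (ModuleCat.{v} R)) :
    ShortComplex (ModuleCat.{v} R) :=
  ShortComplex.mk (homUToPullback u S) (ModuleCat.ofHom (LinearMap.range
    (homUToPullback u S).hom).mkQ) (by
      ext1
      exact LinearMap.range_mkQ_comp _)

variable (u) in
/-- The functor `U ⊗_R -` is right exact. -/
theorem exact_map_tensorU (hS : S.ShortExact) : (S.map (tensorU u)).Exact :=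
  have := hS.epi_g
  ((ShortComplex.exact_and_epi_g_iff_g_is_cokernel (S.map (tensorU u))).2
    ⟨CokernelCofork.mapIsColimit _ hS.gIsCokernel (tensorU u)⟩).1

variable (u) in
theorem tensorU_map_surjective {X Y : ModuleCat.{v} R} (f : X ⟶ Y) [Epi f] :
    Function.Surjective ((tensorU u).map f) :=
  (ModuleCat.epi_iff_surjective _).1 inferInstance

theorem exists_lift_of_ext_one {L : ModuleCat.{v} R} (hS : S.ShortExact)
    (h : Subsingleton (Ext.{v} L S.X₁ 1)) (f : L ⟶ S.X₃) : ∃ g : L ⟶ S.X₂, g ≫ S.g = f := by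
  obtain ⟨x, hx⟩ := Ext.covariant_sequence_exact₃ L hS (Ext.mk₀ f) (zero_add 1) (h.elim _ _)
  obtain ⟨g, rfl⟩ := (Ext.mk₀_bijective _ _).surjective x
  rw [Ext.mk₀_comp_mk₀] at hx
  exact ⟨g, (Ext.mk₀_bijective _ _).injective hx⟩

theorem subsingleton_ext_X₂ {L : ModuleCat.{v} R} (hS : S.ShortExact)
    (h₁ : Subsingleton (Ext.{v} L S.X₁ 1)) (h₃ : Subsingleton (Ext.{v} L S.X₃ 1)) :
    Subsingleton (Ext.{v} L S.X₂ 1) := by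
  refine subsingleton_of_forall_eq 0 fun x => ?_
  obtain ⟨y, rfl⟩ := Ext.covariant_sequence_exact₂ L hS x (h₃.elim _ _)
  rw [h₁.elim y 0, Ext.zero_comp]

theorem subsingleton_ext_X₃ {L : ModuleCat.{v} R} (hS : S.ShortExact)
    (h₁ : Subsingleton (Ext.{v} L S.X₁ 2)) (h₂ : Subsingleton (Ext.{v} L S.X₂ 1)) :
    Subsingleton (Ext.{v} L S.X₃ 1) := by
  refine subsingleton_of_forall_eq 0 fun x => ?_
  obtain ⟨y, rfl⟩ := Ext.covariant_sequence_exact₃ L hS x rfl (h₁.elim _ _)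
  rw [h₂.elim y 0, Ext.zero_comp]

theorem subsingleton_ext_X₁ {L : ModuleCat.{v} R} (hS : S.ShortExact)
    (h₂ : Subsingleton (Ext.{v} L S.X₂ 1)) (h₃ : ∀ f : L ⟶ S.X₃, ∃ g : L ⟶ S.X₂, g ≫ S.g = f) :
    Subsingleton (Ext.{v} L S.X₁ 1) := by
  refine subsingleton_of_forall_eq 0 fun x => ?_
  obtain ⟨y, rfl⟩ := Ext.covariant_sequence_exact₁ L hS x (h₂.elim _ _) (n₀ := 0) rfl
  obtain ⟨f, rfl⟩ := (Ext.mk₀_bijective _ _).surjective y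
  obtain ⟨g, rfl⟩ := h₃ f
  rw [← Ext.mk₀_comp_mk₀, Ext.comp_assoc_of_second_deg_zero, hS.comp_extClass, Ext.comp_zero]

variable (R) in
/-- The split short exact sequence of a product. -/
theorem shortExact_prod (A B : Type v) [AddCommGroup A] [AddCommGroup B] [Module R A] [Module R B] :
    (ShortComplex.mk (ModuleCat.ofHom (LinearMap.inl R A B)) (ModuleCat.ofHom (LinearMap.snd R A B))
      rfl).ShortExact :=
  ModuleCat.shortComplex_shortExact _ Function.Exact.inl_snd LinearMap.inl_injective
    LinearMap.snd_surjective

section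

variable (hu : IsRingEpi u) (h₁ : IsZero ((torU u 1).obj (leftU u))) (hS : S.ShortExact)
include hu h₁ hS

/-- `Ext^1(U, T)` vanishes for the fibre product `T` of `I` and `Hom(U, Z)` over `Z`, because every
map `U → Z` factors through `Hom(U, Z)`. -/
theorem subsingleton_ext_pullback (hI : Injective S.X₂) :
    Subsingleton (Ext.{v} (leftU u) (pullbackHomU u S) 1) := by
  have hsurj : Function.Surjective (subEval u S) := fun z => by
    obtain ⟨x, hx⟩ := hS.moduleCat_surjective_g z
    refine ⟨(x, 0), ?_⟩
    change S.g x - (evalOne u S.X₃).hom 0 = z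
    rw [hx, map_zero, sub_zero]
  have hI' : Subsingleton (Ext.{v} (leftU u) S.X₂ 1) := Ext.subsingleton_of_injective _ _ 0
  have h := subsingleton_ext_X₂ (shortExact_prod R S.X₂ (homU u S.X₃)) hI'
    (subsingleton_ext_one_leftU hu h₁ _)
  have hk := subsingleton_ext_X₁ (L := leftU u) (LinearMap.shortExact_shortComplexKer hsurj) h
    fun f => by
      obtain ⟨g, rfl⟩ := exists_lift_evalOne u (X := S.X₃) f
      refine ⟨-(g ≫ ModuleCat.ofHom (X := homU u S.X₃) (Y := ModuleCat.of R (S.X₂ × homU u S.X₃))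
        (LinearMap.inr R S.X₂ (homU u S.X₃))), ?_⟩
      apply ModuleCat.hom_ext
      apply LinearMap.ext
      intro w
      change S.g (-0) - (evalOne u S.X₃).hom (-(g.hom w)) = (evalOne u S.X₃).hom (g.hom w)
      rw [neg_zero, map_zero, map_neg, sub_neg_eq_add, zero_add]
  exact hk

/-- The quotient `C = T / Hom(U, I)` is a contramodule. The group `Hom(U, C)` vanishes because every
map `U → T` factors through `Hom(U, I)`, and `Ext^1(U, C)` because `Ext^1(U, T)` and
`Ext^2(U, Hom(U, I))` do. -/
theorem isContramodule_pullbackQuotient (h₂ : IsZero ((torU u 2).obj (leftU u)))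
    (hI : Injective S.X₂) (hM : IsCospecial u S.X₁) :
    IsContramodule u (pullbackQuotient u S).X₃ := by
  have hS' : (pullbackQuotient u S).ShortExact := shortExact_homUToPullback u hS hM
  refine ⟨subsingleton_of_forall_eq 0 fun f => ?_, ?_⟩
  · obtain ⟨g, rfl⟩ := exists_lift_of_ext_one hS' (subsingleton_ext_one_leftU hu h₁ _) f
    obtain ⟨k, hk⟩ := exists_lift_evalOne u (g ≫ pullbackFst u S)
    -- both components of `g` come from the map `k : U → Hom(U, I)`
    have hg : g = k ≫ homUToPullback u S := by
      apply pullbackHomU_hom_ext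
      · exact hk.symm
      · apply hom_ext_evalOne hu
        change g ≫ pullbackSnd u S ≫ evalOne u S.X₃ = k ≫ homUMap u S.g ≫ evalOne u S.X₃
        rw [← pullback_condition, homUMap_evalOne, reassoc_of% hk]
    rw [hg, Category.assoc]
    exact (congrArg (k ≫ ·) (pullbackQuotient u S).zero).trans comp_zero
  · exact subsingleton_ext_X₃ hS' (subsingleton_ext_two_leftU hu h₁ h₂ _)
      (subsingleton_ext_pullback hu h₁ hS hI)

omit h₁ in
/-- The quotient `C` of `T` is special if `U ⊗_R M = 0`: then `U ⊗_R T` embeds in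
`U ⊗_R Hom(U, Z) = Hom(U, Z)`, onto which `T` surjects. -/
theorem isSpecial_pullbackQuotient (hM : IsZero ((tensorU u).obj S.X₁)) :
    IsSpecial u (pullbackQuotient u S).X₃ := by
  have hS' := shortExact_kernelToPullback u hS
  have hm := (ModuleCat.mono_iff_injective _).1
    ((exact_map_tensorU u hS').mono_g (hM.eq_of_src _ _))
  have hT : Function.Surjective ((unitMap u).app (pullbackHomU u S)) := fun t => by
    obtain ⟨q, hq⟩ := (unitMap_bijective hu _).surjective ((tensorU u).map (pullbackSnd u S) t)
    obtain ⟨x, rfl⟩ := hS'.moduleCat_surjective_g q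
    exact ⟨x, hm hq⟩
  intro c
  have : Epi (pullbackQuotient u S).g :=
    (ModuleCat.epi_iff_surjective _).2 (Submodule.mkQ_surjective _)
  obtain ⟨t, rfl⟩ := tensorU_map_surjective u (pullbackQuotient u S).g c
  obtain ⟨x, rfl⟩ := hT t
  exact ⟨(pullbackQuotient u S).g x, rfl⟩

end

/-- A cospecial comodule is related to a special contramodule by maps which `Ext^1(K, -)` and
`Tor_1(K, -)` invert. -/
theorem exists_specialContramodule (hu : IsRingEpi u) (h₁ : IsZero ((torU u 1).obj (leftU u)))
    (h₂ : IsZero ((torU u 2).obj (leftU u))) {M : ModuleCat.{v} R}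
    (hM : cospecialComodules u M) :
    ∃ (T C : ModuleCat.{v} R) (i : M ⟶ T) (p : T ⟶ C),
      specialContramodules u C ∧ IsInverted u i ∧ IsInverted u p := by
  let S : ShortComplex (ModuleCat.{v} R) :=
    ShortComplex.mk (Injective.ι M) (cokernel.π (Injective.ι M)) (cokernel.condition _)
  have hS : S.ShortExact :=
    { exact := ShortComplex.exact_cokernel _
      mono_f := inferInstanceAs (Mono (Injective.ι M))
      epi_g := inferInstanceAs (Epi (cokernel.π _)) }
  have hI : Injective S.X₂ := inferInstanceAs (Injective (Injective.under M))
  have hS' : (pullbackQuotient u S).ShortExact := shortExact_homUToPullback u hS hM.1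
  exact ⟨_, _, kernelToPullback u S, (pullbackQuotient u S).g,
    ⟨isSpecial_pullbackQuotient hu hS hM.2.1,
      isContramodule_pullbackQuotient hu h₁ hS h₂ hI hM.1⟩,
    isInverted_of_shortExact_f hu h₁ h₂ (shortExact_kernelToPullback u hS) (Iso.refl _),
    isInverted_of_shortExact_g hu h₁ h₂ hS' (Iso.refl _)⟩

end Pullback

/-! ### From contramodules to comodules -/

section Pushout

open Abelian

variable (S : ShortComplex (ModuleCat.{v} R))

/-- The map `Y → F × (U ⊗ Y)`, `y ↦ (i(y), -1 ⊗ y)`, for an injection `i : Y → F`. -/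
abbrev glueMap : S.X₁ →ₗ[R] S.X₂ × (tensorU u).obj S.X₁ :=
  LinearMap.prod S.f.hom (-((unitMap u).app S.X₁).hom)

/-- The presentation of the amalgamated sum `T` of `F` and `U ⊗ Y` over `Y`. -/
abbrev pushoutSequence : ShortComplex (ModuleCat.{v} R) :=
  ShortComplex.mk (ModuleCat.ofHom (glueMap u S))
    (ModuleCat.ofHom (LinearMap.range (glueMap u S)).mkQ) (by
      ext1
      exact LinearMap.range_mkQ_comp _)

/-- The amalgamated sum of `F` and `U ⊗ Y` over `Y`. -/
abbrev pushoutU : ModuleCat.{v} R := (pushoutSequence u S).X₃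

/-- The map from `F` to the amalgamated sum. -/
abbrev pushoutInl : S.X₂ ⟶ pushoutU u S :=
  ModuleCat.ofHom (LinearMap.inl R S.X₂ ((tensorU u).obj S.X₁)) ≫ (pushoutSequence u S).g

/-- The map from `U ⊗ Y` to the amalgamated sum. -/
abbrev pushoutInr : (tensorU u).obj S.X₁ ⟶ pushoutU u S :=
  ModuleCat.ofHom (X := (tensorU u).obj S.X₁) (Y := (pushoutSequence u S).X₂)
    (LinearMap.inr R S.X₂ ((tensorU u).obj S.X₁)) ≫ (pushoutSequence u S).g

theorem pushout_condition : S.f ≫ pushoutInl u S = (unitMap u).app S.X₁ ≫ pushoutInr u S := by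
  apply ModuleCat.hom_ext
  apply LinearMap.ext
  intro y
  refine (Submodule.Quotient.eq _).2 ⟨y, Prod.ext ?_ ?_⟩
  · exact (sub_zero (S.f.hom y)).symm
  · exact (zero_sub (((unitMap u).app S.X₁).hom y)).symm

/-- The map out of the amalgamated sum given by its restrictions to `F` and `U ⊗ Y`. -/
abbrev pushoutDesc {X : ModuleCat.{v} R} (f : S.X₂ ⟶ X) (g : (tensorU u).obj S.X₁ ⟶ X)
    (w : S.f ≫ f = (unitMap u).app S.X₁ ≫ g) : pushoutU u S ⟶ X :=
  ModuleCat.ofHom (Submodule.liftQ _ (LinearMap.coprod f.hom g.hom) (by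
    rintro _ ⟨y, rfl⟩
    have h := congrArg (fun f => f.hom y) w
    change f.hom (S.f.hom y) = g.hom (((unitMap u).app S.X₁).hom y) at h
    change f.hom (S.f.hom y) + g.hom (-(((unitMap u).app S.X₁).hom y)) = 0
    rw [map_neg, h, add_neg_cancel]))

/-- The map from the amalgamated sum to `C`. -/
abbrev pushoutToCokernel : pushoutU u S ⟶ S.X₃ :=
  pushoutDesc u S S.g 0 (by rw [S.zero, comp_zero])

/-- The map from the amalgamated sum to `U ⊗ F`. -/
abbrev pushoutToTensorU : pushoutU u S ⟶ (tensorU u).obj S.X₂ :=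
  pushoutDesc u S ((unitMap u).app S.X₂) ((tensorU u).map S.f) ((unitMap u).naturality S.f)

theorem pushoutInl_toTensorU :
    pushoutInl u S ≫ pushoutToTensorU u S = (unitMap u).app S.X₂ := by
  apply ModuleCat.hom_ext
  apply LinearMap.ext
  intro y
  change tmul u 1 y + (baseChangeMap u S.f.hom) 0 = tmul u 1 y
  rw [map_zero, add_zero]

variable {S} (hS : S.ShortExact)
include hS

theorem shortExact_pushoutSequence : (pushoutSequence u S).ShortExact :=
  ModuleCat.shortComplex_shortExact _ (fun _ => Submodule.Quotient.mk_eq_zero _)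
    (fun _ _ h => hS.moduleCat_injective_f (congrArg Prod.fst h)) (Submodule.mkQ_surjective _)

theorem shortExact_pushoutToCokernel :
    (ShortComplex.mk (pushoutInr u S) (pushoutToCokernel u S) (by
      apply ModuleCat.hom_ext
      apply LinearMap.ext
      intro y
      exact (add_zero (S.g.hom 0)).trans (map_zero _))).ShortExact := by
  refine ModuleCat.shortComplex_shortExact _ (fun y => ⟨fun hy => ?_, ?_⟩) ?_ (fun c => ?_)
  · obtain ⟨⟨x, t⟩, rfl⟩ := Submodule.mkQ_surjective _ y
    have hx : S.g x = 0 := (add_zero (S.g.hom x)).symm.trans hy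
    obtain ⟨z, rfl⟩ :=
      ((ShortComplex.ShortExact.moduleCat_exact_iff_function_exact S).1 hS.exact x).1 hx
    refine ⟨t + ((unitMap u).app S.X₁).hom z, ?_⟩
    refine (Submodule.Quotient.eq _).2 ⟨-z, Prod.ext ?_ ?_⟩
    · exact (map_neg S.f.hom z).trans (zero_sub (S.f.hom z)).symm
    · change -(((unitMap u).app S.X₁).hom (-z)) = t + ((unitMap u).app S.X₁).hom z - t
      rw [map_neg, neg_neg, add_sub_cancel_left]
  · rintro ⟨t, rfl⟩
    exact (add_zero (S.g.hom 0)).trans (map_zero _)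
  · refine (injective_iff_map_eq_zero (pushoutInr u S).hom).2 fun t ht => ?_
    obtain ⟨y, hy⟩ := (Submodule.Quotient.mk_eq_zero _).1 ht
    have hy₁ : S.f y = 0 := congrArg Prod.fst hy
    have hy₂ : -(((unitMap u).app S.X₁).hom y) = t := congrArg Prod.snd hy
    rw [← hy₂, hS.moduleCat_injective_f (hy₁.trans (map_zero S.f.hom).symm), map_zero, neg_zero]
  · obtain ⟨x, rfl⟩ := hS.moduleCat_surjective_g c
    exact ⟨(pushoutInl u S).hom x, add_zero _⟩

/-- Speciality of `C` makes `T → U ⊗ F` surjective, since `U ⊗ F` is generated by the images of `F`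
and of `U ⊗ Y`. -/
theorem pushoutToTensorU_surjective (hC : IsSpecial u S.X₃) :
    Function.Surjective (pushoutToTensorU u S) := fun s => by
  obtain ⟨c, hc⟩ := hC ((tensorU u).map S.g s)
  obtain ⟨x, rfl⟩ := hS.moduleCat_surjective_g c
  obtain ⟨t, ht⟩ := ((ShortComplex.ShortExact.moduleCat_exact_iff_function_exact _).1
    (exact_map_tensorU u hS) (s - (unitMap u).app S.X₂ x)).1 (by
      change (tensorU u).map S.g (s - (unitMap u).app S.X₂ x) = 0
      rw [map_sub, sub_eq_zero, ← hc]
      rfl)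
  refine ⟨(pushoutSequence u S).g (x, t), ?_⟩
  change (unitMap u).app S.X₂ x + (tensorU u).map S.f t = s
  exact (congrArg ((unitMap u).app S.X₂ x + ·) ht).trans (add_sub_cancel _ _)

section

omit hS in
theorem tensorU_map_comp_apply {X Y Z : ModuleCat.{v} R} (f : X ⟶ Y) (g : Y ⟶ Z)
    (t : (tensorU u).obj X) :
    (tensorU u).map (f ≫ g) t = (tensorU u).map g ((tensorU u).map f t) := by
  rw [Functor.map_comp]
  rfl

variable {u} (hu : IsRingEpi u)
include hu

omit hS in
/-- The two maps `U ⊗ X → U ⊗ (U ⊗ X)` agree. -/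
theorem tensorU_map_unitMap (X : ModuleCat.{v} R) :
    (tensorU u).map ((unitMap u).app X) = (unitMap u).app ((tensorU u).obj X) := by
  apply ModuleCat.hom_ext
  apply LinearMap.ext
  intro t
  induction t using tmul_induction with
  | h w x =>
    refine (tmul_eq_one_tmul hu ((baseChange u).obj X) w (tmul u 1 x)).trans ?_
    have h := smul_tmul u w 1 x
    rw [mul_one] at h
    exact congrArg (tmul u 1) h
  | h_add x y hx hy =>
    exact (map_add _ x y).trans ((congrArg₂ (· + ·) hx hy).trans (map_add _ x y).symm)

omit hS in
theorem isIso_tensorU_map_unitMap (X : ModuleCat.{v} R) :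
    IsIso ((tensorU u).map ((unitMap u).app X)) := by
  rw [tensorU_map_unitMap hu]
  exact isIso_unitMap hu ((baseChange u).obj X)

omit hS in
/-- `U ⊗ F` surjects onto `U ⊗ T`, because `U ⊗ Y → U ⊗ (U ⊗ Y)` is surjective. -/
theorem tensorU_map_pushoutInl_surjective :
    Function.Surjective ((tensorU u).map (pushoutInl u S)) := fun t => by
  induction t using tmul_induction with
  | h w x =>
    obtain ⟨⟨x, y⟩, rfl⟩ := Submodule.mkQ_surjective _ x
    -- `w ⊗ y` comes from `U ⊗ Y`, where `inr` agrees with `inl`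
    have := isIso_tensorU_map_unitMap hu S.X₁
    obtain ⟨z, hz⟩ := ((ConcreteCategory.isIso_iff_bijective _).1 this).surjective (tmul u w y)
    refine ⟨(show (tensorU u).obj S.X₂ from tmul u w x) + (tensorU u).map S.f z, ?_⟩
    have h₁ : (tensorU u).map (pushoutInl u S) ((tensorU u).map S.f z) =
        tmul u w ((pushoutInr u S).hom y) := by
      have h := congrArg (fun f => (tensorU u).map f z) (pushout_condition u S)
      rw [← tensorU_map_comp_apply]
      refine h.trans ((tensorU_map_comp_apply u _ _ z).trans ?_)
      exact congrArg ((tensorU u).map (pushoutInr u S)) hz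
    refine (map_add ((tensorU u).map (pushoutInl u S)).hom (tmul u w x) _).trans ?_
    refine (congrArg (tmul u w ((pushoutInl u S).hom x) + ·) h₁).trans ?_
    refine (tmul_add u w _ _).symm.trans (congrArg (tmul u w) ?_)
    refine (map_add (LinearMap.range (glueMap u S)).mkQ _ _).symm.trans (congrArg _ ?_)
    exact Prod.ext (add_zero x) (zero_add y)
  | h_add x y hx hy =>
    obtain ⟨a, rfl⟩ := hx
    obtain ⟨b, rfl⟩ := hy
    exact ⟨a + b, map_add _ a b⟩

omit hS in
theorem mono_tensorU_map_pushoutToTensorU : Mono ((tensorU u).map (pushoutToTensorU u S)) := by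
  have hi := isIso_tensorU_map_unitMap hu S.X₂
  rw [← pushoutInl_toTensorU, Functor.map_comp, ConcreteCategory.isIso_iff_bijective] at hi
  rw [ModuleCat.mono_iff_injective]
  intro x y hxy
  obtain ⟨x, rfl⟩ := tensorU_map_pushoutInl_surjective hu x
  obtain ⟨y, rfl⟩ := tensorU_map_pushoutInl_surjective hu y
  rw [hi.injective hxy]

/-- `Tor_1(U, T)` vanishes, because it does for `F × (U ⊗ Y)` and the map
`U ⊗ Y → U ⊗ (F × (U ⊗ Y))` is a split injection. -/
theorem isZero_torU_one_pushoutU (h₁ : IsZero ((torU u 1).obj (leftU u)))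
    (hF : IsZero ((torU u 1).obj S.X₂)) : IsZero ((torU u 1).obj (pushoutU u S)) := by
  have h := isZero_torU_X₂ u (shortExact_prod R S.X₂ ((tensorU u).obj S.X₁)) 0 hF
    (isZero_torU_one_res hu h₁ ((baseChange u).obj S.X₁))
  have hm : Mono ((tensorU u).map (pushoutSequence u S).f) := by
    have hi := isIso_tensorU_map_unitMap hu S.X₁
    obtain ⟨ρ, hρ⟩ : ∃ ρ : (pushoutSequence u S).X₂ ⟶ (tensorU u).obj S.X₁,
        (pushoutSequence u S).f ≫ ρ = (unitMap u).app S.X₁ := by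
      refine ⟨ModuleCat.ofHom (X := (pushoutSequence u S).X₂) (Y := (tensorU u).obj S.X₁)
        (-LinearMap.snd R S.X₂ ((tensorU u).obj S.X₁)), ?_⟩
      apply ModuleCat.hom_ext
      apply LinearMap.ext
      intro y
      exact neg_neg (((unitMap u).app S.X₁).hom y)
    rw [← hρ, Functor.map_comp] at hi
    exact mono_of_mono _ ((tensorU u).map ρ)
  have h' := isZero_torU_one_X₃ u (shortExact_pushoutSequence u hS) h hm
  exact h'

section

variable (h₁ : IsZero ((torU u 1).obj (leftU u))) (h₂ : IsZero ((torU u 2).obj (leftU u)))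
  (hF : IsZero ((torU u 1).obj S.X₂)) (hC : specialContramodules u S.X₃)
include h₁ h₂ hF hC

/-- The kernel of `T → U ⊗ F` is a comodule: `U ⊗ T → U ⊗ (U ⊗ F)` is injective, and `Tor_1(U, T)`
and `Tor_2(U, U ⊗ F)` vanish. -/
theorem isComodule_ker_pushoutToTensorU :
    IsComodule u (ModuleCat.of R (LinearMap.ker (pushoutToTensorU u S).hom)) := by
  have hK := LinearMap.shortExact_shortComplexKer (pushoutToTensorU_surjective u hS hC.1)
  have hV := isLocal_res hu h₁ h₂ ((baseChange u).obj S.X₂)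
  constructor
  · have hm := mono_tensorU_map u hK hV.isZero_one
    have hm' := mono_tensorU_map_pushoutToTensorU (S := S) hu
    refine IsZero.of_mono_eq_zero ((tensorU u).map (pushoutToTensorU u S).hom.shortComplexKer.f)
      ((cancel_mono ((tensorU u).map (pushoutToTensorU u S))).1 ?_)
    exact ((tensorU u).map_comp _ _).symm.trans
      ((congrArg (tensorU u).map (pushoutToTensorU u S).hom.shortComplexKer.zero).trans
        (((tensorU u).map_zero _ _).trans zero_comp.symm))
  · have h := isZero_torU_one_X₁ u hK hV.isZero_two (isZero_torU_one_pushoutU hS hu h₁ hF)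
    exact h

omit h₁ h₂ hF in
/-- The kernel of `T → U ⊗ F` is cospecial: since `Hom(U, C) = 0`, a map from `U` to it takes values
in the `U`-module `U ⊗ Y`, so it vanishes if its value at `1` does. -/
theorem isCospecial_ker_pushoutToTensorU :
    IsCospecial u (ModuleCat.of R (LinearMap.ker (pushoutToTensorU u S).hom)) := by
  intro f g hfg
  change f.hom (1 : U) = g.hom (1 : U) at hfg
  rw [← sub_eq_zero]
  have h1 : (f - g).hom (1 : U) = 0 := (sub_eq_zero.2 hfg :)
  generalize f - g = k at h1 ⊢
  have hS' := shortExact_pushoutToCokernel u hS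
  have := hS'.mono_f
  let ι : ModuleCat.of R (LinearMap.ker (pushoutToTensorU u S).hom) ⟶ pushoutU u S :=
    ModuleCat.ofHom (Submodule.subtype _)
  have : Mono ι := (ModuleCat.mono_iff_injective _).2 (Submodule.injective_subtype _)
  obtain ⟨k', hk⟩ : ∃ k' : leftU u ⟶ (res u).obj ((baseChange u).obj S.X₁),
      k' ≫ pushoutInr u S = k ≫ ι :=
    ⟨hS'.exact.lift (k ≫ ι) (hC.2.1.elim _ _), hS'.exact.lift_f _ _⟩
  have hk' : k' = 0 := by
    refine subsingleton_hom_of_eq hu ?_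
    refine (cancel_mono (pushoutInr u S)).1 ?_
    refine ((Category.assoc _ _ _).trans (congrArg (uHom u ≫ ·) hk)).trans ?_
    refine Eq.trans ?_ zero_comp.symm
    apply ModuleCat.hom_ext
    apply LinearMap.ext_ring
    have h2 : k.hom (u 1) = 0 := by rw [map_one]; exact h1
    exact (congrArg ι.hom h2).trans (map_zero ι.hom)
  rw [← cancel_mono ι, ← hk, hk']
  exact zero_comp.trans zero_comp.symm

end

end

end Pushout

/-- A special contramodule is related to a cospecial comodule by maps which `Ext^1(K, -)` and
`Tor_1(K, -)` invert. -/
theorem exists_cospecialComodule {u : R →+* U} (hu : IsRingEpi u)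
    (h₁ : IsZero ((torU u 1).obj (leftU u)))
    (h₂ : IsZero ((torU u 2).obj (leftU u))) {C : ModuleCat.{v} R}
    (hC : specialContramodules u C) :
    ∃ (T M : ModuleCat.{v} R) (i : M ⟶ T) (p : T ⟶ C),
      cospecialComodules u M ∧ IsInverted u i ∧ IsInverted u p := by
  have hS := shortExact_freeCover C
  have hF : IsZero ((torU u 1).obj (freeCover R C).X₂) :=
    isZero_torU_of_projective u 1 one_ne_zero (C →₀ R)
  have hK := LinearMap.shortExact_shortComplexKer (pushoutToTensorU_surjective u hS hC.1)
  exact ⟨_, _, _, pushoutToCokernel u (freeCover R C),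
    ⟨isCospecial_ker_pushoutToTensorU hS hu hC, isComodule_ker_pushoutToTensorU hS hu h₁ h₂ hF hC⟩,
    isInverted_of_shortExact_f hu h₁ h₂ hK (V := (baseChange u).obj (freeCover R C).X₂)
      (Iso.refl _),
    isInverted_of_shortExact_g hu h₁ h₂ (shortExact_pushoutToCokernel u hS)
      (V := (baseChange u).obj (freeCover R C).X₁) (Iso.refl _)⟩

/-! ### The equivalence of categories -/

variable {u}

theorem specialContramodules_of_iso {C D : ModuleCat.{v} R} (e : C ≅ D)
    (hC : specialContramodules u C) : specialContramodules u D := by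
  refine ⟨fun d => ?_, subsingleton_of_forall_eq 0 fun f => ?_,
    subsingleton_of_forall_eq 0 fun x => ?_⟩
  · obtain ⟨t, rfl⟩ := tensorU_map_surjective u e.hom d
    obtain ⟨c, rfl⟩ := hC.1 t
    exact ⟨e.hom c, rfl⟩
  · refine (cancel_mono e.inv).1 ?_
    exact hC.2.1.elim _ _
  · have h : x.comp (Abelian.Ext.mk₀ e.inv) (add_zero 1) = 0 := hC.2.2.elim _ _
    have h' := congrArg (fun y => y.comp (Abelian.Ext.mk₀ e.hom) (add_zero 1)) h
    simpa using h'

theorem cospecialComodules_of_iso {M N : ModuleCat.{v} R} (e : M ≅ N)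
    (hM : cospecialComodules u M) : cospecialComodules u N := by
  refine ⟨fun f g hfg => ?_, hM.2.1.of_iso ((tensorU u).mapIso e.symm),
    hM.2.2.of_iso ((torU u 1).mapIso e.symm)⟩
  refine (cancel_mono e.inv).1 (hM.1 ?_)
  exact congrArg e.inv.hom hfg

section

variable (hu : IsRingEpi u) (h₁ : IsZero ((torU u 1).obj (leftU u)))
  (h₂ : IsZero ((torU u 2).obj (leftU u)))
include hu h₁ h₂

theorem specialContramodules_extK {M : ModuleCat.{v} R} (hM : cospecialComodules u M) :
    specialContramodules u ((extK u 1).obj M) := by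
  obtain ⟨T, C, i, p, hC, hi, hp⟩ := exists_specialContramodule hu h₁ h₂ hM
  have := hi.isIso_extK
  have := hp.isIso_extK
  have := isIso_toExtK_app u hC.2
  exact specialContramodules_of_iso (asIso ((toExtK u).app C) ≪≫
    (asIso ((extK u 1).map p)).symm ≪≫ (asIso ((extK u 1).map i)).symm) hC

theorem cospecialComodules_torK {C : ModuleCat.{v} R} (hC : specialContramodules u C) :
    cospecialComodules u ((torK u 1).obj C) := by
  obtain ⟨T, M, i, p, hM, hi, hp⟩ := exists_cospecialComodule hu h₁ h₂ hC
  have := hi.isIso_torK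
  have := hp.isIso_torK
  have := isIso_fromTorK_app u hM.2
  exact cospecialComodules_of_iso ((asIso ((fromTorK u).app M)).symm ≪≫
    asIso ((torK u 1).map i) ≪≫ asIso ((torK u 1).map p)) hM

/-- Naturality of `toExtK` along maps to a special contramodule which both functors invert reduces
the claim to contramodules. -/
theorem isIso_torK_map_toExtK {M : ModuleCat.{v} R} (hM : cospecialComodules u M) :
    IsIso ((torK u 1).map ((toExtK u).app M)) := by
  obtain ⟨T, C, i, p, hC, hi, hp⟩ := exists_specialContramodule hu h₁ h₂ hM
  have := hi.isIso_extK
  have := hp.isIso_extK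
  have := hi.isIso_torK
  have := hp.isIso_torK
  have := isIso_toExtK_app u hC.2
  have h : (torK u 1).map ((toExtK u).app M) ≫
      (torK u 1).map ((extK u 1).map i ≫ (extK u 1).map p) =
      (torK u 1).map i ≫ (torK u 1).map p ≫ (torK u 1).map ((toExtK u).app C) := by
    rw [← Functor.map_comp, ← Functor.map_comp, ← Functor.map_comp, ← Functor.map_comp]
    exact congrArg _ (((toExtK u).naturality (i ≫ p)).symm.trans (Category.assoc _ _ _))
  have h' : IsIso ((torK u 1).map ((toExtK u).app M) ≫
      (torK u 1).map ((extK u 1).map i ≫ (extK u 1).map p)) := h ▸ inferInstance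
  exact IsIso.of_isIso_comp_right _ ((torK u 1).map ((extK u 1).map i ≫ (extK u 1).map p))

/-- Naturality of `fromTorK` along maps from a cospecial comodule which both functors invert reduces
the claim to comodules. -/
theorem isIso_extK_map_fromTorK {C : ModuleCat.{v} R} (hC : specialContramodules u C) :
    IsIso ((extK u 1).map ((fromTorK u).app C)) := by
  obtain ⟨T, M, i, p, hM, hi, hp⟩ := exists_cospecialComodule hu h₁ h₂ hC
  have := hi.isIso_extK
  have := hp.isIso_extK
  have := hi.isIso_torK
  have := hp.isIso_torK
  have := isIso_fromTorK_app u hM.2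
  have h : (extK u 1).map ((torK u 1).map i ≫ (torK u 1).map p) ≫
      (extK u 1).map ((fromTorK u).app C) =
      (extK u 1).map ((fromTorK u).app M) ≫ (extK u 1).map i ≫ (extK u 1).map p := by
    rw [← Functor.map_comp, ← Functor.map_comp, ← Functor.map_comp, ← Functor.map_comp]
    exact congrArg _ ((fromTorK u).naturality (i ≫ p))
  have h' : IsIso ((extK u 1).map ((torK u 1).map i ≫ (torK u 1).map p) ≫
      (extK u 1).map ((fromTorK u).app C)) := h ▸ inferInstance
  exact IsIso.of_isIso_comp_left ((extK u 1).map ((torK u 1).map i ≫ (torK u 1).map p)) _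

end

section

variable (hExt : ∀ M : (cospecialComodules u).FullSubcategory,
    specialContramodules u ((extK u 1).obj M.obj))
  (hTor : ∀ C : (specialContramodules u).FullSubcategory,
    cospecialComodules u ((torK u 1).obj C.obj))

/-- The functor `Ext^1(K, -)` from cospecial comodules to special contramodules. -/
abbrev extKRestricted :
    (cospecialComodules u).FullSubcategory ⥤ (specialContramodules u).FullSubcategory :=
  (specialContramodules u).lift ((cospecialComodules u).ι ⋙ extK u 1) hExt

/-- The functor `Tor_1(K, -)` from special contramodules to cospecial comodules. -/
abbrev torKRestricted :
    (specialContramodules u).FullSubcategory ⥤ (cospecialComodules u).FullSubcategory :=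
  (cospecialComodules u).lift ((specialContramodules u).ι ⋙ torK u 1) hTor

/-- The isomorphism `M ≅ Tor_1(K, Ext^1(K, M))`, composed of the inverse of
`Tor_1(K, M) → M` and of `Tor_1(K, -)` applied to `M → Ext^1(K, M)`. -/
def unitIso (h : ∀ M : (cospecialComodules u).FullSubcategory,
      IsIso ((torK u 1).map ((toExtK u).app M.obj))) :
    𝟭 _ ≅ extKRestricted hExt ⋙ torKRestricted hTor :=
  have (M : (cospecialComodules u).FullSubcategory) : IsIso ((fromTorK u).app M.obj) :=
    isIso_fromTorK_app u M.property.2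
  NatIso.ofComponents
    (fun M => ObjectProperty.isoMk _
      ((asIso ((fromTorK u).app M.obj)).symm ≪≫ asIso ((torK u 1).map ((toExtK u).app M.obj))))
    fun {M N} f => by
      apply ObjectProperty.hom_ext
      have h₁ : f.hom ≫ inv ((fromTorK u).app N.obj) =
          inv ((fromTorK u).app M.obj) ≫ (torK u 1).map f.hom := by
        rw [IsIso.comp_inv_eq, Category.assoc, IsIso.eq_inv_comp]
        exact ((fromTorK u).naturality f.hom).symm
      have h₂ : (torK u 1).map f.hom ≫ (torK u 1).map ((toExtK u).app N.obj) =
          (torK u 1).map ((toExtK u).app M.obj) ≫ (torK u 1).map ((extK u 1).map f.hom) := by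
        rw [← Functor.map_comp, ← Functor.map_comp]
        exact congrArg _ ((toExtK u).naturality f.hom)
      change f.hom ≫ inv ((fromTorK u).app N.obj) ≫ (torK u 1).map ((toExtK u).app N.obj) =
        (inv ((fromTorK u).app M.obj) ≫ (torK u 1).map ((toExtK u).app M.obj)) ≫
          (torK u 1).map ((extK u 1).map f.hom)
      rw [reassoc_of% h₁, h₂, Category.assoc]

/-- The isomorphism `Ext^1(K, Tor_1(K, C)) ≅ C`, composed of `Ext^1(K, -)` applied to
`Tor_1(K, C) → C` and of the inverse of `C → Ext^1(K, C)`. -/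
def counitIso (h : ∀ C : (specialContramodules u).FullSubcategory,
      IsIso ((extK u 1).map ((fromTorK u).app C.obj))) :
    torKRestricted hTor ⋙ extKRestricted hExt ≅ 𝟭 _ :=
  have (C : (specialContramodules u).FullSubcategory) : IsIso ((toExtK u).app C.obj) :=
    isIso_toExtK_app u C.property.2
  NatIso.ofComponents
    (fun C => ObjectProperty.isoMk _
      (asIso ((extK u 1).map ((fromTorK u).app C.obj)) ≪≫ (asIso ((toExtK u).app C.obj)).symm))
    fun {C D} f => by
      apply ObjectProperty.hom_ext
      have h₁ : (extK u 1).map f.hom ≫ inv ((toExtK u).app D.obj) =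
          inv ((toExtK u).app C.obj) ≫ f.hom := by
        rw [IsIso.comp_inv_eq, Category.assoc, IsIso.eq_inv_comp]
        exact ((toExtK u).naturality f.hom).symm
      have h₂ : (extK u 1).map ((torK u 1).map f.hom) ≫ (extK u 1).map ((fromTorK u).app D.obj) =
          (extK u 1).map ((fromTorK u).app C.obj) ≫ (extK u 1).map f.hom := by
        rw [← Functor.map_comp, ← Functor.map_comp]
        exact congrArg _ ((fromTorK u).naturality f.hom)
      change (extK u 1).map ((torK u 1).map f.hom) ≫
          (extK u 1).map ((fromTorK u).app D.obj) ≫ inv ((toExtK u).app D.obj) =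
        ((extK u 1).map ((fromTorK u).app C.obj) ≫ inv ((toExtK u).app C.obj)) ≫ f.hom
      rw [reassoc_of% h₂, h₁, Category.assoc]

theorem additive_extKRestricted : (extKRestricted hExt).Additive where
  map_add {_ _ f g} := by
    apply ObjectProperty.hom_ext
    exact (extK u 1).map_add (f := f.hom) (g := g.hom)

end

end
end Matlis

theorem mainTheorem2 {R U : Type v} [Ring R] [Ring U] (u : R →+* U)
    (hu : Matlis.IsRingEpi u)
    (h₁ : IsZero ((Matlis.torU u 1).obj (Matlis.leftU u)))
    (h₂ : IsZero ((Matlis.torU u 2).obj (Matlis.leftU u))) :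
    ∃ (hExt : ∀ M : (Matlis.cospecialComodules u).FullSubcategory,
        Matlis.specialContramodules u ((Matlis.extK u 1).obj M.obj))
      (hTor : ∀ C : (Matlis.specialContramodules u).FullSubcategory,
        Matlis.cospecialComodules u ((Matlis.torK u 1).obj C.obj))
      (e : (Matlis.cospecialComodules u).FullSubcategory ≌
        (Matlis.specialContramodules u).FullSubcategory),
      e.functor = (Matlis.specialContramodules u).lift
        ((Matlis.cospecialComodules u).ι ⋙ Matlis.extK u 1) hExt ∧
      e.inverse = (Matlis.cospecialComodules u).lift
        ((Matlis.specialContramodules u).ι ⋙ Matlis.torK u 1) hTor ∧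
      e.functor.Additive ∧ e.inverse.Additive := by
  have hExt (M : (Matlis.cospecialComodules u).FullSubcategory) :=
    Matlis.specialContramodules_extK hu h₁ h₂ M.property
  have hTor (C : (Matlis.specialContramodules u).FullSubcategory) :=
    Matlis.cospecialComodules_torK hu h₁ h₂ C.property
  let e := CategoryTheory.Equivalence.mk (Matlis.extKRestricted hExt) (Matlis.torKRestricted hTor)
    (Matlis.unitIso hExt hTor fun M => Matlis.isIso_torK_map_toExtK hu h₁ h₂ M.property)
    (Matlis.counitIso hExt hTor fun C => Matlis.isIso_extK_map_fromTorK hu h₁ h₂ C.property)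
  have he : e.functor.Additive := Matlis.additive_extKRestricted hExt
  exact ⟨hExt, hTor, e, rfl, rfl, he, inferInstance⟩
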